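/- Let $R_0:=e^{1/(2e)}$, $T>0$ and $R>R_0$, and write $D(z_0,r)=\{z\in\mathbb C:\ |z-z_0|<r\}$ and $H(\Omega)$ for the set of holomorphic functions $\Omega\to\mathbb C$. A function $y\in C^\infty([0,T];\mathbb C)$ belongs to $G^2([0,T])$ if there are $C,\rho>0$ with $|y^{(p)}(t)|\le C\,(p!)^2/\rho^p$ for all $p\in\mathbb N$, $t\in[0,T]$. A function $\theta\in C^\infty([a,b]\times[0,T];\mathbb C)$ belongs to $G^{1,2}([a,b]\times[0,T])$ if there are $C,\rho_1,\rho_2>0$ with $|\partial_x^{p}\partial_t^{q}\theta(x,t)|\le C\,p!\,(q!)^2/(\rho_1^{p}\rho_2^{q})$ for all $p,q\in\mathbb N$, $(x,t)\in[a,b]\times[0,T]$. For $(\alpha_0,\beta_0),(\alpha_1,\beta_1)\in\mathbb R^2\setminus\{(0,0)\}$ and $a<b$ consider the control problem $$\psi_t-\psi_{xx}=0\ \ (x\in(a,b),\ t\in(0,T)),\qquad \psi(x,0)=0\ \ (x\in(a,b)),$$ $$\alpha_0\psi(a,t)+\beta_0\psi_x(a,t)=h_0(t),\qquad \alpha_1\psi(b,t)+\beta_1\psi_x(b,t)=h_1(t)\qquad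 (t\in(0,T)),$$ whose solutions are understood in the classical sense and continuous on $[a,b]\times[0,T]$. **Theorem.** (i) Let $(a,b)=(-1,1)$ and let $(\alpha_0,\beta_0),(\alpha_1,\beta_1)\in\mathbb R^2\setminus\{(0,0)\}$ be arbitrary. For every $\psi_T\in H(D(0,R))$ there exist control functions $h_0,h_1\in G^2([0,T])$ such that the control problem has a unique solution $\psi$, this solution belongs to $G^{1,2}([-1,1]\times[0,T])$, and $\psi(x,T)=\psi_T(x)$ for all $x\in[-1,1]$. (ii) Let $(a,b)=(0,1)$ and $(\alpha_0,\beta_0)=(\alpha_1,\beta_1)=(1,0)$ (Dirichlet controls). For every $\psi_1\in H(D(\tfrac12,\tfrac R2))$ there exist control functions $h_0,h_1\in G^2([0,T])$ such that the control problem has a unique solution $\psi$, this solution belongs to $G^{1,2}([0,1]\times[0,T])$, and $\psi(x,T)=\psi_1(x)$ for all $x\in[0,1]$. -/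

import Mathlib

open scoped ContDiff

/-- The constant `R₀ = e^{1/(2e)}`. -/
noncomputable def criticalRadius : ℝ := Real.exp ((2 * Real.exp 1)⁻¹)

/-- `y ∈ G^s([t₁,t₂])`: `y` is smooth on the closed interval (one-sided derivatives at the end
points) and `|y^{(p)}(t)| ≤ C (p!)^s / R^p` for all `p` and all `t ∈ [t₁,t₂]`. -/
def GevreyOn (s t₁ t₂ : ℝ) (y : ℝ → ℂ) : Prop :=
  ContDiffOn ℝ ∞ y (Set.Icc t₁ t₂) ∧
    ∃ C > (0 : ℝ), ∃ R > (0 : ℝ), ∀ p : ℕ, ∀ t ∈ Set.Icc t₁ t₂,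
      ‖iteratedDerivWithin p y (Set.Icc t₁ t₂) t‖ ≤ C * (p.factorial : ℝ) ^ s / R ^ p

/-- `∂ₓ^{p₁} ∂ₜ^{p₂} θ (x,t)` on the closed rectangle `[x₁,x₂] × [t₁,t₂]`
(one-sided derivatives on the boundary). -/
noncomputable def mixedPartial (x₁ x₂ t₁ t₂ : ℝ) (p₁ p₂ : ℕ) (θ : ℝ → ℝ → ℂ) (x t : ℝ) : ℂ :=
  iteratedDerivWithin p₁
    (fun ξ => iteratedDerivWithin p₂ (fun τ => θ ξ τ) (Set.Icc t₁ t₂) t) (Set.Icc x₁ x₂) x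

/-- `θ ∈ G^{s₁,s₂}([x₁,x₂] × [t₁,t₂])`: `θ` is smooth on the closed rectangle and
`|∂ₓ^{p₁} ∂ₜ^{p₂} θ| ≤ C (p₁!)^{s₁} (p₂!)^{s₂} / (R₁^{p₁} R₂^{p₂})` there. -/
def GevreyOnRect (s₁ s₂ x₁ x₂ t₁ t₂ : ℝ) (θ : ℝ → ℝ → ℂ) : Prop :=
  ContDiffOn ℝ ∞ (fun q : ℝ × ℝ => θ q.1 q.2) (Set.Icc x₁ x₂ ×ˢ Set.Icc t₁ t₂) ∧
    ∃ C > (0 : ℝ), ∃ R₁ > (0 : ℝ), ∃ R₂ > (0 : ℝ), ∀ p₁ p₂ : ℕ,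
      ∀ x ∈ Set.Icc x₁ x₂, ∀ t ∈ Set.Icc t₁ t₂,
        ‖mixedPartial x₁ x₂ t₁ t₂ p₁ p₂ θ x t‖ ≤
          C * ((p₁.factorial : ℝ) ^ s₁ * (p₂.factorial : ℝ) ^ s₂) / (R₁ ^ p₁ * R₂ ^ p₂)

/-- The Robin condition `α u(x) + β u'(x) = h` at an end point `x` of the interval `I`, the
derivative being one-sided. Its existence is part of the condition unless `β = 0`. -/
def RobinCondition (α β : ℝ) (I : Set ℝ) (u : ℝ → ℂ) (x : ℝ) (h : ℂ) : Prop :=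
  (β ≠ 0 → DifferentiableWithinAt ℝ u I x) ∧
    (α : ℂ) * u x + (β : ℂ) * derivWithin u I x = h

/-- `ψ` (written `ψ x t`) is a classical solution, continuous on `[a,b] × [0,T]`, of
`ψ_t - ψ_xx = 0` in `(a,b) × (0,T)`,
`α₀ ψ(a,t) + β₀ ψ_x(a,t) = h₀(t)` and `α₁ ψ(b,t) + β₁ ψ_x(b,t) = h₁(t)` for `t ∈ (0,T)`,
`ψ(x,0) = 0` for `x ∈ (a,b)`. -/
structure IsControlledHeatSolution (a b T α₀ β₀ α₁ β₁ : ℝ) (h₀ h₁ : ℝ → ℂ)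
    (ψ : ℝ → ℝ → ℂ) : Prop where
  continuousOn :
    ContinuousOn (fun q : ℝ × ℝ => ψ q.1 q.2) (Set.Icc a b ×ˢ Set.Icc 0 T)
  differentiable_time : ∀ x ∈ Set.Ioo a b, ∀ t ∈ Set.Ioo 0 T,
    DifferentiableAt ℝ (fun τ => ψ x τ) t
  contDiff_space : ∀ x ∈ Set.Ioo a b, ∀ t ∈ Set.Ioo 0 T,
    ContDiffAt ℝ 2 (fun ξ => ψ ξ t) x
  heat : ∀ x ∈ Set.Ioo a b, ∀ t ∈ Set.Ioo 0 T,
    deriv (fun τ => ψ x τ) t - iteratedDeriv 2 (fun ξ => ψ ξ t) x = 0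
  left_boundary : ∀ t ∈ Set.Ioo 0 T,
    RobinCondition α₀ β₀ (Set.Icc a b) (fun ξ => ψ ξ t) a (h₀ t)
  right_boundary : ∀ t ∈ Set.Ioo 0 T,
    RobinCondition α₁ β₁ (Set.Icc a b) (fun ξ => ψ ξ t) b (h₁ t)
  initial : ∀ x ∈ Set.Ioo a b, ψ x 0 = 0

/-- `ψ` is the solution of the control problem: it is one, and every other one agrees with it
on `[a,b] × [0,T]`. -/
def IsTheControlledHeatSolution (a b T α₀ β₀ α₁ β₁ : ℝ) (h₀ h₁ : ℝ → ℂ)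
    (ψ : ℝ → ℝ → ℂ) : Prop :=
  IsControlledHeatSolution a b T α₀ β₀ α₁ β₁ h₀ h₁ ψ ∧
    ∀ φ : ℝ → ℝ → ℂ, IsControlledHeatSolution a b T α₀ β₀ α₁ β₁ h₀ h₁ φ →
      ∀ x ∈ Set.Icc a b, ∀ t ∈ Set.Icc 0 T, φ x t = ψ x t

/-!
The reachability statement holds for every interval `[c - l, c + l]`, all Robin conditions, and
every final state `f` holomorphic on a disc of centre `c` and radius `l R` with `R > 1`; the
constant `e^{1/(2e)}` enters only through being larger than `1`.

**The final state.** In Cauchy's formula for `f` on a circle of radius `l r` with `1 < r < R`, the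
kernel is a Laplace integral, `1 / (ζ - x) = ω ∫₀^∞ e^{-μω(ζ - x)} dμ`, provided
`Re (ω (ζ - x)) > 0`. With `ω = ±ρ ± i`, `1 < ρ < r`, the signs depending on the quadrant of
`ζ - c`, this holds uniformly for `x ∈ [c - l, c + l]`, and moreover `Re ω² = ρ² - 1 > 0`. So `f` is
a superposition of exponentials `e^{λ(x - c)}` (`exists_expSuperposition`), and replacing them by
`e^{λ(x - c) + λ²(t - T)}` gives a solution `U` of the heat equation with final state `f`. Its space
derivatives satisfy `|∂ₓⁿ U| ≤ C Kⁿ n!` up to `t = T` (`ExpSuperposition.heatJet`); as a time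
derivative is two space derivatives, this gives analyticity in space and Gevrey order two in time
(`HeatJet.gevreyOnRect`).

**The initial state.** For `t < T` the factor `e^{λ²(t - T)}` decays like a Gaussian in `|λ|`. So
`U` is entire in `x`, and its flat outputs `U(c, t)` and `Uₓ(c, t)` are analytic in `t`. A solution
is recovered from its flat outputs `y`, `z` by
`∑ y⁽ⁱ⁾ (x - c)²ⁱ / (2i)! + ∑ z⁽ⁱ⁾ (x - c)²ⁱ⁺¹ / (2i + 1)!`, which converges near `[c - l, c + l]` if
`y` and `z` are Gevrey of order two with a small geometric constant. Functions built from `e^{-b/t}`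
with `b` large provide a cut-off `χ` of that kind (`exists_gevrey_cutoff`), and the flat outputs
`χ U(c, ·)`, `χ Uₓ(c, ·)` define a solution which vanishes at `t = 0` and agrees with `U` once
`χ = 1` (`exists_heatJet`).

**Uniqueness.** The real part of any complex multiple of the difference of two solutions, weighted
by `e^{-px - qx²/2 - Λt}`, has no positive maximum: the quadratic is chosen so that the Robin
conditions, whatever their signs, force a derivative of the wrong sign at the end points
(`heat_nonpos`).
-/

namespace HeatControl

open Set Filter Topology MeasureTheory

/-! ### Differentiation within convex sets by quadratic remainders -/

/-- Taylor's inequality of second order, with one-sided derivatives at boundary points. -/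
theorem norm_sub_sub_smul_le_of_hasDerivWithinAt {F : Type*} [NormedAddCommGroup F]
    [NormedSpace ℝ F] {f f' f'' : ℝ → F} {s : Set ℝ} {B : ℝ} (hs : Convex ℝ s)
    (hf : ∀ x ∈ s, HasDerivWithinAt f (f' x) s x) (hf' : ∀ x ∈ s, HasDerivWithinAt f' (f'' x) s x)
    (hB : ∀ x ∈ s, ‖f'' x‖ ≤ B) {x y : ℝ} (hx : x ∈ s) (hy : y ∈ s) :
    ‖f y - f x - (y - x) • f' x‖ ≤ B * ‖y - x‖ ^ 2 := by
  set t : Set ℝ := s ∩ Metric.closedBall x ‖y - x‖ with ht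
  have hts : t ⊆ s := inter_subset_left
  have htc : Convex ℝ t := hs.inter (convex_closedBall _ _)
  have hxt : x ∈ t := ⟨hx, by simp⟩
  have hyt : y ∈ t := ⟨hy, by simp [dist_eq_norm]⟩
  have hB0 : 0 ≤ B := (norm_nonneg _).trans (hB x hx)
  have key := Convex.norm_image_sub_le_of_norm_hasDerivWithin_le (𝕜 := ℝ)
    (f := fun z => f z - z • f' x) (f' := fun z => f' z - f' x) (s := t) (C := B * ‖y - x‖)
    (fun z hz => ?_) (fun z hz => ?_) htc hxt hyt
  · calc ‖f y - f x - (y - x) • f' x‖ = ‖f y - y • f' x - (f x - x • f' x)‖ := by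
          congr 1; rw [sub_smul]; abel
      _ ≤ _ := key
      _ = _ := by ring
  · have h2 : HasDerivWithinAt (fun z : ℝ => z • f' x) ((1 : ℝ) • f' x) t z :=
      (hasDerivWithinAt_id z t).smul_const (f' x)
    rw [one_smul] at h2
    exact ((hf z (hts hz)).mono hts).sub h2
  · have h1 := Convex.norm_image_sub_le_of_norm_hasDerivWithin_le hf' hB hs hx (hts hz)
    refine h1.trans (mul_le_mul_of_nonneg_left ?_ hB0)
    have := hz.2
    rwa [Metric.mem_closedBall, dist_eq_norm] at this

theorem hasDerivWithinAt_of_norm_sub_le_sq {F : Type*} [NormedAddCommGroup F]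
    [NormedSpace ℝ F] {f : ℝ → F} {f' : F} {s : Set ℝ} {x B : ℝ}
    (h : ∀ y ∈ s, ‖f y - f x - (y - x) • f'‖ ≤ B * ‖y - x‖ ^ 2) :
    HasDerivWithinAt f f' s x := by
  rw [hasDerivWithinAt_iff_isLittleO]
  refine Asymptotics.IsBigO.trans_isLittleO (g := fun y => ‖y - x‖ ^ 2) ?_
    ((Asymptotics.isLittleO_pow_sub_sub x (by norm_num)).mono nhdsWithin_le_nhds)
  refine Asymptotics.IsBigO.of_bound B ?_
  filter_upwards [self_mem_nhdsWithin] with y hy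
  simpa using h y hy

/-- Differentiation under the integral sign within a convex set, boundary points included. -/
theorem hasDerivWithinAt_integral {X : Type*} [MeasurableSpace X] {ν : MeasureTheory.Measure X}
    {s : Set ℝ} (hs : Convex ℝ s) {f f' f'' : X → ℝ → ℂ} {B : X → ℝ}
    (hf : ∀ ξ, ∀ x ∈ s, HasDerivWithinAt (f ξ) (f' ξ x) s x)
    (hf' : ∀ ξ, ∀ x ∈ s, HasDerivWithinAt (f' ξ) (f'' ξ x) s x)
    (hB : ∀ ξ, ∀ x ∈ s, ‖f'' ξ x‖ ≤ B ξ) (hBi : MeasureTheory.Integrable B ν)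
    (hi : ∀ x ∈ s, MeasureTheory.Integrable (fun ξ => f ξ x) ν)
    (hi' : ∀ x ∈ s, MeasureTheory.Integrable (fun ξ => f' ξ x) ν) {x : ℝ} (hx : x ∈ s) :
    HasDerivWithinAt (fun y => ∫ ξ, f ξ y ∂ν) (∫ ξ, f' ξ x ∂ν) s x := by
  refine hasDerivWithinAt_of_norm_sub_le_sq (B := ∫ ξ, B ξ ∂ν) fun y hy => ?_
  have e : (∫ ξ, f ξ y ∂ν) - (∫ ξ, f ξ x ∂ν) - (y - x) • ∫ ξ, f' ξ x ∂ν
      = ∫ ξ, (f ξ y - f ξ x - (y - x) • f' ξ x) ∂ν := by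
    rw [← MeasureTheory.integral_smul, ← MeasureTheory.integral_sub (hi y hy) (hi x hx)]
    exact (MeasureTheory.integral_sub ((hi y hy).sub (hi x hx)) ((hi' x hx).smul (y - x))).symm
  rw [e, ← MeasureTheory.integral_mul_const]
  refine MeasureTheory.norm_integral_le_of_norm_le (hBi.mul_const _) (Eventually.of_forall ?_)
  exact fun ξ => norm_sub_sub_smul_le_of_hasDerivWithinAt hs (hf ξ) (hf' ξ) (hB ξ) hx hy

/-- Termwise differentiation of a series within a convex set, boundary points included. -/
theorem hasDerivWithinAt_tsum' {s : Set ℝ} (hs : Convex ℝ s) {f f' f'' : ℕ → ℝ → ℂ} {B : ℕ → ℝ}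
    (hf : ∀ k, ∀ x ∈ s, HasDerivWithinAt (f k) (f' k x) s x)
    (hf' : ∀ k, ∀ x ∈ s, HasDerivWithinAt (f' k) (f'' k x) s x)
    (hB : ∀ k, ∀ x ∈ s, ‖f'' k x‖ ≤ B k) (hBi : Summable B)
    (hi : ∀ x ∈ s, Summable (fun k => f k x))
    (hi' : ∀ x ∈ s, Summable (fun k => f' k x)) {x : ℝ} (hx : x ∈ s) :
    HasDerivWithinAt (fun y => ∑' k, f k y) (∑' k, f' k x) s x := by
  refine hasDerivWithinAt_of_norm_sub_le_sq (B := ∑' k, B k) fun y hy => ?_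
  have e : (∑' k, f k y) - (∑' k, f k x) - (y - x) • ∑' k, f' k x
      = ∑' k, (f k y - f k x - (y - x) • f' k x) := by
    rw [← (hi' x hx).tsum_const_smul, ← (hi y hy).tsum_sub (hi x hx),
      ← ((hi y hy).sub (hi x hx)).tsum_sub ((hi' x hx).const_smul _)]
  rw [e, ← tsum_mul_right]
  exact tsum_of_norm_bounded (hBi.mul_right _).hasSum
    fun k => norm_sub_sub_smul_le_of_hasDerivWithinAt hs (hf k) (hf' k) (hB k) hx hy

/-- `n!` and `k!` are comparable to `(n + k)!` up to a geometric factor. -/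
theorem factorial_add_le (n k : ℕ) :
    ((n + k).factorial : ℝ) ≤ 2 ^ (n + k) * n.factorial * k.factorial := by
  rw [← Nat.add_choose_mul_factorial_mul_factorial n k]
  have h : ((n + k).choose k : ℝ) ≤ 2 ^ (n + k) := by exact_mod_cast Nat.choose_le_two_pow _ _
  push_cast
  gcongr

theorem factorial_add_two_mul_le (p q : ℕ) :
    ((p + 2 * q).factorial : ℝ) ≤ 4 ^ (p + 2 * q) * p.factorial * (q.factorial : ℝ) ^ 2 := by
  have h1 := factorial_add_le p (2 * q)
  have h2 := factorial_add_le q q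
  rw [← two_mul] at h2
  calc ((p + 2 * q).factorial : ℝ)
      ≤ 2 ^ (p + 2 * q) * p.factorial * (2 * q).factorial := h1
    _ ≤ 2 ^ (p + 2 * q) * p.factorial * (2 ^ (2 * q) * q.factorial * q.factorial) := by gcongr
    _ ≤ 2 ^ (p + 2 * q) * p.factorial * (2 ^ (p + 2 * q) * q.factorial * q.factorial) := by
        gcongr
        · norm_num
        · omega
    _ = 4 ^ (p + 2 * q) * p.factorial * (q.factorial : ℝ) ^ 2 := by
        rw [show (4 : ℝ) = 2 * 2 by norm_num, mul_pow]; ring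

/-! ### Jets of functions of one variable -/

section Jet

variable {F : ℕ → ℝ → ℂ} {s : Set ℝ}

/-- The step `r` is `1` for space derivatives, and `2` for time derivatives, of a solution of the
heat equation indexed by its space derivatives. -/
theorem iteratedDerivWithin_eq_of_jet (hs : UniqueDiffOn ℝ s) {r : ℕ}
    (hF : ∀ n, ∀ x ∈ s, HasDerivWithinAt (F n) (F (n + r) x) s x) (k n : ℕ) :
    EqOn (iteratedDerivWithin k (F n) s) (F (n + r * k)) s := by
  induction k with
  | zero => intro x _; simp
  | succ k ih =>
    intro x hx
    rw [iteratedDerivWithin_succ, derivWithin_congr ih (ih hx),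
      (hF (n + r * k) x hx).derivWithin (hs x hx)]
    rw [show n + r * k + r = n + r * (k + 1) by ring]

theorem contDiffOn_of_jet (hs : UniqueDiffOn ℝ s) {r : ℕ}
    (hF : ∀ n, ∀ x ∈ s, HasDerivWithinAt (F n) (F (n + r) x) s x) (n : ℕ) :
    ContDiffOn ℝ ∞ (F n) s := by
  refine contDiffOn_of_differentiableOn_deriv (n := ⊤) fun m _ => ?_
  have h : DifferentiableOn ℝ (F (n + r * m)) s :=
    fun x hx => (hF _ x hx).differentiableWithinAt
  exact h.congr (iteratedDerivWithin_eq_of_jet hs hF m n)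

end Jet

/-! ### Jets of solutions of the heat equation -/

/-- A sequence `V n` of functions on the rectangle `I × J` that behaves like the sequence of space
derivatives `∂ₓⁿ ψ` of a solution `ψ = V 0` of the heat equation, analytic in space: `V (n + 1)` is
the space derivative of `V n`, `V (n + 2)` is its time derivative (both taken within the rectangle,
hence one-sided on the boundary), and `V n` is bounded by `C Kⁿ n!`. -/
structure HeatJet (I J : Set ℝ) (V : ℕ → ℝ → ℝ → ℂ) : Prop where
  space : ∀ n, ∀ x ∈ I, ∀ t ∈ J, HasDerivWithinAt (fun ξ => V n ξ t) (V (n + 1) x t) I x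
  time : ∀ n, ∀ x ∈ I, ∀ t ∈ J, HasDerivWithinAt (fun τ => V n x τ) (V (n + 2) x t) J t
  bound : ∃ C > (0 : ℝ), ∃ K > (0 : ℝ), ∀ n, ∀ x ∈ I, ∀ t ∈ J,
    ‖V n x t‖ ≤ C * K ^ n * n.factorial

namespace HeatJet

variable {I J : Set ℝ} {V : ℕ → ℝ → ℝ → ℂ}

/-- The total derivative of `V n`. -/
noncomputable def totalDeriv (V : ℕ → ℝ → ℝ → ℂ) (n : ℕ) (q : ℝ × ℝ) : ℝ × ℝ →L[ℝ] ℂ :=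
  (ContinuousLinearMap.fst ℝ ℝ ℝ).smulRight (V (n + 1) q.1 q.2) +
    (ContinuousLinearMap.snd ℝ ℝ ℝ).smulRight (V (n + 2) q.1 q.2)

theorem hasFDerivWithinAt (h : HeatJet I J V) (hI : Convex ℝ I) (hJ : Convex ℝ J) (n : ℕ)
    {q : ℝ × ℝ} (hq : q ∈ I ×ˢ J) :
    HasFDerivWithinAt (fun q : ℝ × ℝ => V n q.1 q.2) (totalDeriv V n q) (I ×ˢ J) q := by
  obtain ⟨C, hC, K, hK, hb⟩ := h.bound
  obtain ⟨x, t⟩ := q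
  obtain ⟨hx, ht⟩ := hq
  simp only at hx ht
  set B : ℕ → ℝ := fun m => C * K ^ m * m.factorial
  have hB0 : ∀ m, 0 ≤ B m := fun m => by positivity
  apply HasFDerivWithinAt.of_isLittleO
  refine Asymptotics.IsBigO.trans_isLittleO (g := fun y => ‖y - (x, t)‖ ^ 2) ?_
    ((Asymptotics.isLittleO_pow_sub_sub (x, t) (by norm_num)).mono nhdsWithin_le_nhds)
  refine Asymptotics.IsBigO.of_bound (B (n + 4) + B (n + 2) + B (n + 3)) ?_
  filter_upwards [self_mem_nhdsWithin] with y hy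
  obtain ⟨x', t'⟩ := y
  obtain ⟨hx', ht'⟩ := hy
  simp only at hx' ht'
  have e1 := norm_sub_sub_smul_le_of_hasDerivWithinAt hJ (h.time n x' hx') (h.time (n + 2) x' hx')
    (hb (n + 4) x' hx') ht ht'
  have e2 := norm_sub_sub_smul_le_of_hasDerivWithinAt hI (fun ξ hξ => h.space n ξ hξ t ht)
    (fun ξ hξ => h.space (n + 1) ξ hξ t ht) (fun ξ hξ => hb (n + 2) ξ hξ t ht) hx hx'
  have e3 := Convex.norm_image_sub_le_of_norm_hasDerivWithin_le
    (fun ξ hξ => h.space (n + 2) ξ hξ t ht) (fun ξ hξ => hb (n + 3) ξ hξ t ht) hI hx hx'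
  set N := ‖((x', t') : ℝ × ℝ) - (x, t)‖
  have n1 : ‖x' - x‖ ≤ N := norm_fst_le (((x', t') : ℝ × ℝ) - (x, t))
  have n2 : ‖t' - t‖ ≤ N := norm_snd_le (((x', t') : ℝ × ℝ) - (x, t))
  have hN0 : 0 ≤ N := norm_nonneg _
  rw [Real.norm_of_nonneg (by positivity : 0 ≤ N ^ 2)]
  have split : V n x' t' - V n x t - totalDeriv V n (x, t) ((x', t') - (x, t))
      = (V n x' t' - V n x' t - (t' - t) • V (n + 2) x' t)
        + (V n x' t - V n x t - (x' - x) • V (n + 1) x t)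
        + (t' - t) • (V (n + 2) x' t - V (n + 2) x t) := by
    simp only [totalDeriv, add_apply, ContinuousLinearMap.smulRight_apply,
      ContinuousLinearMap.coe_fst', ContinuousLinearMap.coe_snd', Prod.fst_sub, Prod.snd_sub,
      smul_sub]
    abel
  simp only
  rw [split]
  have i1 : B (n + 4) * ‖t' - t‖ ^ 2 ≤ B (n + 4) * N ^ 2 := by gcongr
  have i2 : B (n + 2) * ‖x' - x‖ ^ 2 ≤ B (n + 2) * N ^ 2 := by gcongr
  have i3 : ‖(t' - t) • (V (n + 2) x' t - V (n + 2) x t)‖ ≤ B (n + 3) * N ^ 2 := by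
    rw [norm_smul]
    calc ‖t' - t‖ * ‖V (n + 2) x' t - V (n + 2) x t‖ ≤ N * (B (n + 3) * N) := by
          refine mul_le_mul n2 (e3.trans ?_) (norm_nonneg _) hN0
          exact mul_le_mul_of_nonneg_left n1 (hB0 _)
      _ = _ := by ring
  calc _ ≤ _ := norm_add₃_le
    _ ≤ B (n + 4) * N ^ 2 + B (n + 2) * N ^ 2 + B (n + 3) * N ^ 2 :=
        add_le_add (add_le_add (e1.trans i1) (e2.trans i2)) i3
    _ = _ := by ring

theorem contDiffOn (h : HeatJet I J V) (hI : Convex ℝ I) (hJ : Convex ℝ J)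
    (hI' : UniqueDiffOn ℝ I) (hJ' : UniqueDiffOn ℝ J) (n : ℕ) :
    ContDiffOn ℝ ∞ (fun q : ℝ × ℝ => V n q.1 q.2) (I ×ˢ J) := by
  rw [contDiffOn_infty]
  intro m
  induction m generalizing n with
  | zero =>
    rw [Nat.cast_zero, contDiffOn_zero]
    exact fun q hq => (h.hasFDerivWithinAt hI hJ n hq).continuousWithinAt
  | succ m ih =>
    rw [Nat.cast_succ]
    refine contDiffOn_succ_of_fderivWithin
      (fun q hq => (h.hasFDerivWithinAt hI hJ n hq).differentiableWithinAt) (by simp) ?_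
    refine ContDiffOn.congr (f := totalDeriv V n) ?_ fun q hq =>
      (h.hasFDerivWithinAt hI hJ n hq).fderivWithin (hI'.prod hJ' q hq)
    exact (contDiffOn_const.smulRight (ih (n + 1))).add (contDiffOn_const.smulRight (ih (n + 2)))

variable {a b T : ℝ}

theorem mixedPartial_eq (hab : a < b) (hT : 0 < T) (h : HeatJet (Icc a b) (Icc 0 T) V)
    (p q : ℕ) {x t : ℝ} (hx : x ∈ Icc a b) (ht : t ∈ Icc 0 T) :
    mixedPartial a b 0 T p q (V 0) x t = V (p + 2 * q) x t := by
  unfold mixedPartial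
  have h1 : EqOn (fun ξ => iteratedDerivWithin q (fun τ => V 0 ξ τ) (Icc 0 T) t)
      (fun ξ => V (2 * q) ξ t) (Icc a b) := fun ξ hξ => by
    have := iteratedDerivWithin_eq_of_jet (uniqueDiffOn_Icc hT) (F := fun n τ => V n ξ τ)
      (fun n τ hτ => h.time n ξ hξ τ hτ) q 0 ht
    simpa using this
  rw [iteratedDerivWithin_congr h1 hx]
  have := iteratedDerivWithin_eq_of_jet (uniqueDiffOn_Icc hab) (F := fun n ξ => V n ξ t)
    (fun n ξ hξ => h.space n ξ hξ t ht) p (2 * q) hx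
  rw [this, mul_comm 1 p, mul_one, add_comm]

theorem gevreyOnRect (hab : a < b) (hT : 0 < T) (h : HeatJet (Icc a b) (Icc 0 T) V) :
    GevreyOnRect 1 2 a b 0 T (V 0) := by
  refine ⟨h.contDiffOn (convex_Icc _ _) (convex_Icc _ _) (uniqueDiffOn_Icc hab)
    (uniqueDiffOn_Icc hT) 0, ?_⟩
  obtain ⟨C, hC, K, hK, hb⟩ := h.bound
  refine ⟨C, hC, (4 * K)⁻¹, by positivity, ((4 * K) ^ 2)⁻¹, by positivity, ?_⟩
  intro p q x hx t ht
  rw [h.mixedPartial_eq hab hT p q hx ht]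
  refine (hb _ x hx t ht).trans ?_
  rw [Real.rpow_one, Real.rpow_two]
  calc C * K ^ (p + 2 * q) * (p + 2 * q).factorial
      ≤ C * K ^ (p + 2 * q) * (4 ^ (p + 2 * q) * p.factorial * (q.factorial : ℝ) ^ 2) := by
        gcongr; exact factorial_add_two_mul_le p q
    _ = C * (p.factorial * (q.factorial : ℝ) ^ 2) * (4 * K) ^ (p + 2 * q) := by
        rw [mul_pow]; ring
    _ = _ := by
        rw [inv_pow, inv_pow, ← mul_inv, div_inv_eq_mul, ← pow_mul, ← pow_add]

theorem gevreyOn_boundary (hT : 0 < T) (h : HeatJet (Icc a b) (Icc 0 T) V)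
    {x : ℝ} (hx : x ∈ Icc a b) (α β : ℂ) :
    GevreyOn 2 0 T (fun t => α * V 0 x t + β * V 1 x t) := by
  have hj : ∀ n, ∀ t ∈ Icc 0 T,
      HasDerivWithinAt (fun τ => α * V n x τ + β * V (n + 1) x τ)
        (α * V (n + 2) x t + β * V (n + 2 + 1) x t) (Icc 0 T) t := fun n t ht =>
    ((h.time n x hx t ht).const_mul α).add ((h.time (n + 1) x hx t ht).const_mul β)
  refine ⟨contDiffOn_of_jet (F := fun n t => α * V n x t + β * V (n + 1) x t) (r := 2)
    (uniqueDiffOn_Icc hT) hj 0, ?_⟩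
  obtain ⟨C, hC, K, hK, hb⟩ := h.bound
  refine ⟨(‖α‖ + ‖β‖ * (4 * K) + 1) * C, by positivity, ((4 * K) ^ 2)⁻¹, by positivity, ?_⟩
  intro p t ht
  have e := iteratedDerivWithin_eq_of_jet (F := fun n t => α * V n x t + β * V (n + 1) x t)
    (r := 2) (uniqueDiffOn_Icc hT) hj p 0 ht
  simp only [Nat.zero_add] at e
  rw [e, Real.rpow_two, inv_pow, div_inv_eq_mul, ← pow_mul]
  have b0 := factorial_add_two_mul_le 0 p
  have b1 := factorial_add_two_mul_le 1 p
  simp only [Nat.zero_add, Nat.factorial_zero, Nat.factorial_one, Nat.cast_one, mul_one,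
    Nat.add_comm 1] at b0 b1
  have c0 : ‖V (2 * p) x t‖ ≤ C * (4 * K) ^ (2 * p) * (p.factorial : ℝ) ^ 2 :=
    (hb (2 * p) x hx t ht).trans <| by
      calc C * K ^ (2 * p) * (2 * p).factorial
          ≤ C * K ^ (2 * p) * (4 ^ (2 * p) * (p.factorial : ℝ) ^ 2) := by gcongr
        _ = _ := by rw [mul_pow]; ring
  have c1 : ‖V (2 * p + 1) x t‖ ≤ C * (4 * K) ^ (2 * p + 1) * (p.factorial : ℝ) ^ 2 :=
    (hb (2 * p + 1) x hx t ht).trans <| by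
      calc C * K ^ (2 * p + 1) * (2 * p + 1).factorial
          ≤ C * K ^ (2 * p + 1) * (4 ^ (2 * p + 1) * (p.factorial : ℝ) ^ 2) := by gcongr
        _ = _ := by rw [mul_pow]; ring
  calc ‖α * V (2 * p) x t + β * V (2 * p + 1) x t‖
      ≤ ‖α‖ * ‖V (2 * p) x t‖ + ‖β‖ * ‖V (2 * p + 1) x t‖ := by
        simpa only [norm_mul] using norm_add_le (α * V (2 * p) x t) (β * V (2 * p + 1) x t)
    _ ≤ ‖α‖ * (C * (4 * K) ^ (2 * p) * (p.factorial : ℝ) ^ 2)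
        + ‖β‖ * (C * (4 * K) ^ (2 * p + 1) * (p.factorial : ℝ) ^ 2) := by gcongr
    _ = (‖α‖ + ‖β‖ * (4 * K)) * (C * (4 * K) ^ (2 * p) * (p.factorial : ℝ) ^ 2) := by ring
    _ ≤ (‖α‖ + ‖β‖ * (4 * K) + 1) * (C * (4 * K) ^ (2 * p) * (p.factorial : ℝ) ^ 2) := by
        exact mul_le_mul_of_nonneg_right (by linarith) (by positivity)
    _ = _ := by ring

theorem isControlledHeatSolution (hab : a < b) (hT : 0 < T)
    (h : HeatJet (Icc a b) (Icc 0 T) V) (h0 : ∀ x ∈ Icc a b, V 0 x 0 = 0) (α₀ β₀ α₁ β₁ : ℝ) :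
    IsControlledHeatSolution a b T α₀ β₀ α₁ β₁
      (fun t => α₀ * V 0 a t + β₀ * V 1 a t) (fun t => α₁ * V 0 b t + β₁ * V 1 b t) (V 0) := by
  have hc := h.contDiffOn (convex_Icc _ _) (convex_Icc _ _) (uniqueDiffOn_Icc hab)
    (uniqueDiffOn_Icc hT)
  have hspace : ∀ n, ∀ x ∈ Ioo a b, ∀ t ∈ Ioo 0 T,
      HasDerivAt (fun ξ => V n ξ t) (V (n + 1) x t) x := fun n x hx t ht =>
    (h.space n x (Ioo_subset_Icc_self hx) t (Ioo_subset_Icc_self ht)).hasDerivAt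
      (Icc_mem_nhds hx.1 hx.2)
  have htime : ∀ x ∈ Ioo a b, ∀ t ∈ Ioo 0 T,
      HasDerivAt (fun τ => V 0 x τ) (V 2 x t) t := fun x hx t ht =>
    (h.time 0 x (Ioo_subset_Icc_self hx) t (Ioo_subset_Icc_self ht)).hasDerivAt
      (Icc_mem_nhds ht.1 ht.2)
  have hbd : ∀ α β : ℝ, ∀ x ∈ Icc a b, ∀ t ∈ Ioo 0 T,
      RobinCondition α β (Icc a b) (fun ξ => V 0 ξ t) x (α * V 0 x t + β * V 1 x t) := by
    intro α β x hx t ht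
    have := h.space 0 x hx t (Ioo_subset_Icc_self ht)
    refine ⟨fun _ => this.differentiableWithinAt, ?_⟩
    rw [this.derivWithin (uniqueDiffOn_Icc hab x hx)]
  refine ⟨(hc 0).continuousOn, fun x hx t ht => (htime x hx t ht).differentiableAt, ?_, ?_,
    hbd α₀ β₀ a (left_mem_Icc.2 hab.le), hbd α₁ β₁ b (right_mem_Icc.2 hab.le),
    fun x hx => h0 x (Ioo_subset_Icc_self hx)⟩
  · intro x hx t ht
    have := contDiffOn_of_jet (F := fun n ξ => V n ξ t) (r := 1) (uniqueDiffOn_Icc hab)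
      (fun n ξ hξ => h.space n ξ hξ t (Ioo_subset_Icc_self ht)) 0
    exact (contDiffOn_infty.1 this 2).contDiffAt (Icc_mem_nhds hx.1 hx.2)
  · intro x hx t ht
    rw [(htime x hx t ht).deriv, iteratedDeriv_succ, iteratedDeriv_one]
    have e : deriv (fun ξ => V 0 ξ t) =ᶠ[𝓝 x] fun ξ => V 1 ξ t := by
      filter_upwards [Ioo_mem_nhds hx.1 hx.2] with ξ hξ
      exact (hspace 0 ξ hξ t ht).deriv
    rw [e.deriv_eq, (hspace 1 x hx t ht).deriv, sub_self]

end HeatJet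

/-! ### Uniqueness for the boundary value problem -/

theorem hasDerivWithinAt_nonpos_of_isMaxOn_left {f : ℝ → ℝ} {f' a b : ℝ} (hab : a < b)
    (hf : HasDerivWithinAt f f' (Icc a b) a) (hm : ∀ x ∈ Icc a b, f x ≤ f a) : f' ≤ 0 := by
  have h1 : IsLocalMaxOn f (Icc a b) a := eventually_of_mem self_mem_nhdsWithin hm
  have h2 : b - a ∈ posTangentConeAt (Icc a b) a :=
    sub_mem_posTangentConeAt_of_segment_subset (segment_eq_Icc hab.le).subset
  have h3 := h1.hasFDerivWithinAt_nonpos hf.hasFDerivWithinAt h2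
  have h4 : (b - a) * f' ≤ 0 := by simpa using h3
  exact nonpos_of_mul_nonpos_right h4 (sub_pos.2 hab)

theorem hasDerivWithinAt_nonneg_of_isMaxOn_right {f : ℝ → ℝ} {f' a b : ℝ} (hab : a < b)
    (hf : HasDerivWithinAt f f' (Icc a b) b) (hm : ∀ x ∈ Icc a b, f x ≤ f b) : 0 ≤ f' := by
  have h1 : IsLocalMaxOn f (Icc a b) b := eventually_of_mem self_mem_nhdsWithin hm
  have h2 : a - b ∈ posTangentConeAt (Icc a b) b := by
    refine sub_mem_posTangentConeAt_of_segment_subset ?_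
    rw [segment_symm, segment_eq_Icc hab.le]
  have h3 := h1.hasFDerivWithinAt_nonpos hf.hasFDerivWithinAt h2
  have h4 : (a - b) * f' ≤ 0 := by simpa using h3
  nlinarith

theorem deriv_deriv_nonpos_of_isLocalMax {v : ℝ → ℝ} {x : ℝ} (hv : ContinuousAt v x)
    (hm : IsLocalMax v x) : deriv (deriv v) x ≤ 0 := by
  by_contra! h
  have h2 := isLocalMin_of_deriv_deriv_pos h hm.deriv_eq_zero hv
  have h3 : v =ᶠ[𝓝 x] fun _ => v x := by
    filter_upwards [hm, h2] with y h4 h5 using le_antisymm h4 h5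
  have h4 : deriv v =ᶠ[𝓝 x] fun _ => (0 : ℝ) := by
    simpa using h3.deriv
  rw [h4.deriv_eq] at h
  simp at h

theorem hasDerivAt_exp_neg_quadratic (p q x : ℝ) :
    HasDerivAt (fun ξ => Real.exp (-(p * ξ + q * ξ ^ 2 / 2)))
      (-(p + q * x) * Real.exp (-(p * x + q * x ^ 2 / 2))) x := by
  have h1 : HasDerivAt (fun ξ : ℝ => -(p * ξ + q * ξ ^ 2 / 2))
      (-(p * 1 + q * ((2 : ℕ) * x ^ (2 - 1)) / 2)) x :=
    (((hasDerivAt_id x).const_mul p).add (((hasDerivAt_pow 2 x).const_mul q).div_const 2)).neg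
  refine h1.exp.congr_deriv ?_
  push_cast
  ring

theorem _root_.ContDiffAt.hasDerivAt_deriv {E : Type*} [NormedAddCommGroup E] [NormedSpace ℝ E]
    {f : ℝ → E} {x : ℝ} (hf : ContDiffAt ℝ 2 f x) :
    HasDerivAt (deriv f) (deriv (deriv f) x) x := by
  have h1 : ContDiffAt ℝ 1 (fderiv ℝ f) x := hf.fderiv_right (by norm_num)
  have h2 : DifferentiableAt ℝ (fun ξ => fderiv ℝ f ξ 1) x :=
    (h1.differentiableAt (by norm_num)).clm_apply (differentiableAt_const _)
  exact h2.hasDerivAt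

/-- At an interior maximum of `A e^{-px - qx²/2}`, the second derivative of `A` is controlled by
the value of `A`. -/
theorem deriv_deriv_le_of_isLocalMax {A : ℝ → ℝ} {x p q : ℝ} (hA : ContDiffAt ℝ 2 A x)
    (hm : IsLocalMax (fun ξ => A ξ * Real.exp (-(p * ξ + q * ξ ^ 2 / 2))) x) :
    deriv (deriv A) x ≤ (q + (p + q * x) ^ 2) * A x := by
  set m : ℝ → ℝ := fun ξ => Real.exp (-(p * ξ + q * ξ ^ 2 / 2)) with hmdef
  have hmd : ∀ ξ, HasDerivAt m (-(p + q * ξ) * m ξ) ξ := hasDerivAt_exp_neg_quadratic p q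
  have hd : ∀ᶠ ξ in 𝓝 x, DifferentiableAt ℝ A ξ := by
    filter_upwards [hA.eventually (by simp)] with ξ hξ using hξ.differentiableAt (by norm_num)
  have hd2 : HasDerivAt (deriv A) (deriv (deriv A) x) x := hA.hasDerivAt_deriv
  have hv' : ∀ ξ, DifferentiableAt ℝ A ξ →
      HasDerivAt (fun ξ => A ξ * m ξ) ((deriv A ξ - (p + q * ξ) * A ξ) * m ξ) ξ := fun ξ hξ => by
    refine (hξ.hasDerivAt.mul (hmd ξ)).congr_deriv ?_
    ring
  have e : deriv (fun ξ => A ξ * m ξ) =ᶠ[𝓝 x]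
      fun ξ => (deriv A ξ - (p + q * ξ) * A ξ) * m ξ := by
    filter_upwards [hd] with ξ hξ using (hv' ξ hξ).deriv
  have hdx := hd.self_of_nhds
  have h0 := hm.deriv_eq_zero
  have h00 := (hv' x hdx).deriv
  have hmpos : 0 < m x := Real.exp_pos _
  have h1 : deriv A x = (p + q * x) * A x := by
    rw [h00] at h0
    rcases mul_eq_zero.1 h0 with h | h
    · linarith
    · exact absurd h hmpos.ne'
  have hlin : HasDerivAt (fun ξ : ℝ => p + q * ξ) q x := by
    simpa using ((hasDerivAt_id x).const_mul q).const_add p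
  have h2 := ((hd2.sub (hlin.mul hdx.hasDerivAt)).mul (hmd x))
  have h3 := deriv_deriv_nonpos_of_isLocalMax (hv' x hdx).continuousAt hm
  rw [e.deriv_eq] at h3
  have h4 := h2.deriv
  change deriv (fun ξ => (deriv A ξ - (p + q * ξ) * A ξ) * m ξ) x = _ at h4
  rw [h4] at h3
  simp only [Pi.sub_apply, Pi.mul_apply] at h3
  have h5 : (deriv (deriv A) x - (q + (p + q * x) ^ 2) * A x) * m x ≤ 0 := by
    refine le_trans (le_of_eq ?_) h3
    rw [h1]; ring
  have := nonpos_of_mul_nonpos_left h5 hmpos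
  linarith

/-- The maximum principle behind uniqueness, for Robin conditions of either sign. The weight
`e^{-px - qx²/2}` is chosen so that the weighted function has an outward derivative of the sign
opposite to its value at both end points, and `e^{-Λt}` absorbs the terms which the weight
produces in the equation. -/
theorem heat_nonpos {a b T : ℝ} (hab : a < b) (hT : 0 < T) {w : ℝ → ℝ → ℝ}
    (hc : ContinuousOn (fun q : ℝ × ℝ => w q.1 q.2) (Icc a b ×ˢ Icc 0 T))
    (ht : ∀ x ∈ Ioo a b, ∀ t ∈ Ioo 0 T, DifferentiableAt ℝ (fun τ => w x τ) t)
    (hx : ∀ x ∈ Ioo a b, ∀ t ∈ Ioo 0 T, ContDiffAt ℝ 2 (fun ξ => w ξ t) x)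
    (heat : ∀ x ∈ Ioo a b, ∀ t ∈ Ioo 0 T,
      deriv (fun τ => w x τ) t = deriv (deriv fun ξ => w ξ t) x)
    (ka kb : ℝ)
    (ha : ∀ t ∈ Ioo 0 T,
      w a t = 0 ∨ HasDerivWithinAt (fun ξ => w ξ t) (ka * w a t) (Icc a b) a)
    (hb : ∀ t ∈ Ioo 0 T,
      w b t = 0 ∨ HasDerivWithinAt (fun ξ => w ξ t) (kb * w b t) (Icc a b) b)
    (h0 : ∀ x ∈ Ioo a b, w x 0 = 0) :
    ∀ x ∈ Icc a b, ∀ t ∈ Icc 0 T, w x t ≤ 0 := by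
  have hba : 0 < b - a := sub_pos.2 hab
  -- The initial condition extends to the corners by continuity.
  have h0' : ∀ x ∈ Icc a b, w x 0 = 0 := by
    have hcl : closure (Ioo a b) = Icc a b := closure_Ioo hab.ne
    have hcx : ContinuousOn (fun x => w x 0) (Icc a b) :=
      hc.comp (f := fun x : ℝ => ((x, 0) : ℝ × ℝ)) (by fun_prop)
        fun x hx => ⟨hx, left_mem_Icc.2 hT.le⟩
    have := EqOn.of_subset_closure (f := fun x => w x 0) (g := fun _ => (0 : ℝ)) (s := Ioo a b)
      (t := Icc a b) h0 hcx continuousOn_const Ioo_subset_Icc_self hcl.ge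
    exact this
  -- It suffices to treat times before `T`.
  suffices H : ∀ t ∈ Ioo 0 T, ∀ x ∈ Icc a b, w x t ≤ 0 by
    intro x hx t ht
    have hct : ContinuousOn (fun t => w x t) (Icc 0 T) :=
      hc.comp (f := fun t : ℝ => ((x, t) : ℝ × ℝ)) (by fun_prop) fun t ht => ⟨hx, ht⟩
    have hcl : closure (Ioo 0 T) = Icc 0 T := closure_Ioo hT.ne
    rw [← hcl] at hct ht
    exact ht |> fun h => closure_minimal (t := {t | t ∈ closure (Ioo 0 T) ∧ w x t ≤ 0})
      (fun t ht => ⟨subset_closure ht, H t ht x hx⟩)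
      (hct.preimage_isClosed_of_isClosed isClosed_closure isClosed_Iic) h |>.2
  intro t₁ ht₁ x₁ hx₁
  by_contra! hpos
  set q : ℝ := (kb + 1 - (ka - 1)) / (b - a) with hq
  set p : ℝ := ka - 1 - q * a with hp
  have hpa : p + q * a = ka - 1 := by rw [hp]; ring
  have hpb : p + q * b = kb + 1 := by
    have : q * (b - a) = kb + 1 - (ka - 1) := by rw [hq]; field_simp
    rw [hp]; linarith
  set L : ℝ := |q| + (|p| + |q| * (|a| + |b|)) ^ 2 + 1 with hL
  set m : ℝ → ℝ := fun ξ => Real.exp (-(p * ξ + q * ξ ^ 2 / 2)) with hmdef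
  have hmpos : ∀ ξ, 0 < m ξ := fun ξ => Real.exp_pos _
  have hmd : ∀ ξ, HasDerivAt m (-(p + q * ξ) * m ξ) ξ := hasDerivAt_exp_neg_quadratic p q
  set v : ℝ × ℝ → ℝ := fun z => w z.1 z.2 * m z.1 * Real.exp (-L * z.2) with hv
  have hcv : ContinuousOn v (Icc a b ×ˢ Icc 0 t₁) := by
    have h1 : ContinuousOn (fun q : ℝ × ℝ => w q.1 q.2) (Icc a b ×ˢ Icc 0 t₁) :=
      hc.mono (prod_mono le_rfl (Icc_subset_Icc_right ht₁.2.le))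
    refine (h1.mul (Continuous.continuousOn ?_)).mul (Continuous.continuousOn ?_)
    · simp only [hmdef]; fun_prop
    · fun_prop
  obtain ⟨⟨x, t⟩, ⟨hxI, htI⟩, hmax⟩ := (isCompact_Icc.prod isCompact_Icc).exists_isMaxOn
    ⟨(x₁, t₁), hx₁, right_mem_Icc.2 ht₁.1.le⟩ hcv
  simp only at hxI htI
  have hvpos : 0 < v (x, t) := by
    refine lt_of_lt_of_le ?_ (hmax (show (x₁, t₁) ∈ _ from ⟨hx₁, right_mem_Icc.2 ht₁.1.le⟩))
    simp only [hv]
    have := hmpos x₁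
    positivity
  have hw : 0 < w x t := by
    have h1 : 0 < m x * Real.exp (-L * t) := mul_pos (hmpos x) (Real.exp_pos _)
    have h2 : 0 < w x t * (m x * Real.exp (-L * t)) := by
      rw [← mul_assoc]; exact hvpos
    exact pos_of_mul_pos_left h2 h1.le
  have ht0 : 0 < t := by
    rcases htI.1.eq_or_lt with h | h
    · rw [← h, h0' x hxI] at hw; exact absurd hw (lt_irrefl _)
    · exact h
  have htT : t ∈ Ioo 0 T := ⟨ht0, htI.2.trans_lt ht₁.2⟩
  have hmaxx : ∀ ξ ∈ Icc a b, w ξ t * m ξ ≤ w x t * m x := fun ξ hξ =>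
    le_of_mul_le_mul_right (hmax (show (ξ, t) ∈ _ from ⟨hξ, htI⟩)) (Real.exp_pos _)
  rcases hxI.1.eq_or_lt with rfl | hxa
  · rcases ha t htT with h | h
    · exact hw.ne' h
    · have := hasDerivWithinAt_nonpos_of_isMaxOn_left hab (h.mul (hmd a).hasDerivWithinAt) hmaxx
      rw [hpa] at this
      have h3 := mul_pos hw (hmpos a)
      linarith
  rcases hxI.2.eq_or_lt with rfl | hxb
  · rcases hb t htT with h | h
    · exact hw.ne' h
    · have := hasDerivWithinAt_nonneg_of_isMaxOn_right hab (h.mul (hmd x).hasDerivWithinAt) hmaxx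
      rw [hpb] at this
      have h3 := mul_pos hw (hmpos x)
      linarith
  have hxi : x ∈ Ioo a b := ⟨hxa, hxb⟩
  have hmx : IsLocalMax (fun ξ => w ξ t * m ξ) x := by
    filter_upwards [Icc_mem_nhds hxa hxb] with ξ hξ using hmaxx ξ hξ
  have hA := deriv_deriv_le_of_isLocalMax (hx x hxi t htT) hmx
  have hE : HasDerivAt (fun τ : ℝ => Real.exp (-L * τ)) (Real.exp (-L * t) * (-L)) t := by
    simpa using ((hasDerivAt_id t).const_mul (-L)).exp
  have hmaxt : ∀ τ ∈ Icc 0 t, w x τ * Real.exp (-L * τ) ≤ w x t * Real.exp (-L * t) := by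
    intro τ hτ
    have h1 : v (x, τ) ≤ v (x, t) :=
      hmax (show (x, τ) ∈ _ from ⟨hxI, hτ.1, hτ.2.trans htI.2⟩)
    simp only [hv] at h1
    refine le_of_mul_le_mul_right ?_ (hmpos x)
    linarith
  have hB := hasDerivWithinAt_nonneg_of_isMaxOn_right ht0
    (((ht x hxi t htT).hasDerivAt.mul hE).hasDerivWithinAt) hmaxt
  have hB' : L * w x t ≤ deriv (fun τ => w x τ) t := by
    have h1 : 0 ≤ (deriv (fun τ => w x τ) t - L * w x t) * Real.exp (-L * t) := by
      refine hB.trans (le_of_eq ?_); ring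
    have := nonneg_of_mul_nonneg_left h1 (Real.exp_pos _)
    linarith
  rw [heat x hxi t htT] at hB'
  have h1 : L * w x t ≤ (q + (p + q * x) ^ 2) * w x t := hB'.trans hA
  have h2 : L ≤ q + (p + q * x) ^ 2 := le_of_mul_le_mul_right h1 hw
  have hxabs : |x| ≤ |a| + |b| := by
    rw [abs_le]
    constructor
    · linarith [neg_abs_le a, abs_nonneg b]
    · linarith [le_abs_self b, abs_nonneg a]
  have h3 : |p + q * x| ≤ |p| + |q| * (|a| + |b|) := by
    refine (abs_add_le _ _).trans ?_
    rw [abs_mul]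
    gcongr
  have h4 : (p + q * x) ^ 2 ≤ (|p| + |q| * (|a| + |b|)) ^ 2 := by
    rw [← sq_abs (p + q * x)]
    gcongr
  linarith [le_abs_self q]

/-- For the difference of two solutions a Robin condition becomes a homogeneous Dirichlet condition
or prescribes the logarithmic derivative `-α / β`. -/
theorem robin_difference {α β : ℝ} (hαβ : (α, β) ≠ (0, 0)) {I : Set ℝ} {x : ℝ}
    {u v : ℝ → ℂ} {h : ℂ} (hu : RobinCondition α β I u x h) (hv : RobinCondition α β I v x h)
    (η : ℂ) :
    (η * (u x - v x)).re = 0 ∨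
      HasDerivWithinAt (fun ξ => (η * (u ξ - v ξ)).re) (-α / β * (η * (u x - v x)).re) I x := by
  by_cases hβ : β = 0
  · left
    have hα : (α : ℂ) ≠ 0 := by
      intro h; exact hαβ (by simp [hβ, Complex.ofReal_eq_zero.1 h])
    have e : (α : ℂ) * u x = α * v x := by
      have := hu.2.trans hv.2.symm
      simpa [hβ] using this
    rw [mul_left_cancel₀ hα e]
    simp
  · right
    have hβ' : (β : ℂ) ≠ 0 := Complex.ofReal_ne_zero.2 hβ
    have h1 := (((hu.1 hβ).hasDerivWithinAt.sub (hv.1 hβ).hasDerivWithinAt)).const_mul η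
    have h2 := Complex.reCLM.hasFDerivAt.comp_hasDerivWithinAt x h1
    have e : derivWithin u I x - derivWithin v I x = ((-α / β : ℝ) : ℂ) * (u x - v x) := by
      push_cast
      field_simp
      linear_combination hu.2 - hv.2
    rw [e] at h2
    refine h2.congr_deriv ?_
    rw [mul_left_comm, Complex.reCLM_apply, Complex.re_ofReal_mul]

theorem controlledHeatSolution_unique {a b T α₀ β₀ α₁ β₁ : ℝ} (hab : a < b) (hT : 0 < T)
    (h₀ne : (α₀, β₀) ≠ (0, 0)) (h₁ne : (α₁, β₁) ≠ (0, 0)) {h₀ h₁ : ℝ → ℂ} {φ ψ : ℝ → ℝ → ℂ}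
    (hφ : IsControlledHeatSolution a b T α₀ β₀ α₁ β₁ h₀ h₁ φ)
    (hψ : IsControlledHeatSolution a b T α₀ β₀ α₁ β₁ h₀ h₁ ψ) :
    ∀ x ∈ Icc a b, ∀ t ∈ Icc 0 T, φ x t = ψ x t := by
  have key : ∀ η : ℂ, ∀ x ∈ Icc a b, ∀ t ∈ Icc 0 T, (η * (φ x t - ψ x t)).re ≤ 0 := by
    intro η
    have hcl : ∀ z : ℂ, (η * z).re = (Complex.reCLM ∘L (ContinuousLinearMap.mul ℝ ℂ η)) z :=
      fun z => by simp
    refine heat_nonpos hab hT (w := fun x t => (η * (φ x t - ψ x t)).re) ?_ ?_ ?_ ?_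
      (-α₀ / β₀) (-α₁ / β₁)
      (fun t ht => robin_difference h₀ne (hφ.left_boundary t ht) (hψ.left_boundary t ht) η)
      (fun t ht => robin_difference h₁ne (hφ.right_boundary t ht) (hψ.right_boundary t ht) η) ?_
    · exact Complex.continuous_re.comp_continuousOn
        (continuousOn_const.mul (hφ.continuousOn.sub hψ.continuousOn))
    · intro x hx t ht
      simp only [hcl]
      exact (ContinuousLinearMap.differentiableAt _).comp t
        ((hφ.differentiable_time x hx t ht).sub (hψ.differentiable_time x hx t ht))
    · intro x hx t ht
      simp only [hcl]
      exact ((hφ.contDiff_space x hx t ht).sub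
        (hψ.contDiff_space x hx t ht)).continuousLinearMap_comp _
    · intro x hx t ht
      simp only [hcl]
      set Λ := Complex.reCLM ∘L (ContinuousLinearMap.mul ℝ ℂ η)
      have d1 := (hφ.differentiable_time x hx t ht).hasDerivAt.sub
        (hψ.differentiable_time x hx t ht).hasDerivAt
      have d2 := (Λ.hasFDerivAt.comp_hasDerivAt t d1).deriv
      have c1 := hφ.contDiff_space x hx t ht
      have c2 := hψ.contDiff_space x hx t ht
      have e1 : ∀ {f : ℝ → ℂ}, ContDiffAt ℝ 2 f x →
          HasDerivAt (deriv f) (iteratedDeriv 2 f x) x := by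
        intro f hf
        rw [iteratedDeriv_succ, iteratedDeriv_one]
        exact hf.hasDerivAt_deriv
      have e2 : deriv (fun ξ => Λ (φ ξ t - ψ ξ t)) =ᶠ[𝓝 x]
          fun ξ => Λ (deriv (fun ξ => φ ξ t) ξ - deriv (fun ξ => ψ ξ t) ξ) := by
        filter_upwards [c1.eventually (by simp), c2.eventually (by simp)] with ξ h1 h2
        exact (Λ.hasFDerivAt.comp_hasDerivAt ξ ((h1.differentiableAt (by norm_num)).hasDerivAt.sub
          (h2.differentiableAt (by norm_num)).hasDerivAt)).deriv
      rw [e2.deriv_eq]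
      have d3 := (Λ.hasFDerivAt.comp_hasDerivAt x ((e1 c1).sub (e1 c2))).deriv
      refine d2.trans (Eq.trans ?_ d3.symm)
      congr 1
      linear_combination hφ.heat x hx t ht - hψ.heat x hx t ht
    · intro x hx
      simp [hφ.initial x hx, hψ.initial x hx]
  intro x hx t ht
  -- Rotate the difference onto the positive real axis.
  have h1 := key (starRingEnd ℂ (φ x t - ψ x t)) x hx t ht
  rw [← Complex.normSq_eq_conj_mul_self, Complex.ofReal_re] at h1
  exact sub_eq_zero.1 (Complex.normSq_eq_zero.1 (le_antisymm h1 (Complex.normSq_nonneg _)))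

/-! ### Gevrey cut-off functions of order two with an arbitrarily small constant -/

/-- The complex exponential `e^{-1/w}` is holomorphic off the origin, together with all its
derivatives, and restricts to `expNegInvGlue` on the positive half-line. -/
theorem iteratedDeriv_expNegInvGlue_eq_re (n : ℕ) {x : ℝ} (hx : 0 < x) :
    iteratedDeriv n expNegInvGlue x =
      (iteratedDeriv n (fun w : ℂ => Complex.exp (-w⁻¹)) (x : ℂ)).re := by
  have hd : ∀ n : ℕ, ∀ y : ℝ, 0 < y →
      DifferentiableAt ℂ (iteratedDeriv n (fun w : ℂ => Complex.exp (-w⁻¹))) (y : ℂ) := by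
    intro n y hy
    have ha : AnalyticAt ℂ (fun w : ℂ => Complex.exp (-w⁻¹)) (y : ℂ) :=
      ((analyticAt_id.inv (by simpa using hy.ne')).neg).cexp
    rw [iteratedDeriv_eq_iterate]
    exact (ha.iterated_deriv n).differentiableAt
  induction n generalizing x with
  | zero =>
    rw [iteratedDeriv_zero, iteratedDeriv_zero, expNegInvGlue, if_neg hx.not_ge]
    rw [← Complex.ofReal_inv, ← Complex.ofReal_neg, Complex.exp_ofReal_re]
  | succ n ih =>
    rw [iteratedDeriv_succ, iteratedDeriv_succ]
    have e : iteratedDeriv n expNegInvGlue =ᶠ[𝓝 x] fun y : ℝ =>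
        (iteratedDeriv n (fun w : ℂ => Complex.exp (-w⁻¹)) (y : ℂ)).re := by
      filter_upwards [Ioi_mem_nhds hx] with y hy using ih hy
    rw [e.deriv_eq]
    exact (hd n x hx).hasDerivAt.real_of_complex.deriv

theorem pow_mul_exp_neg_le_factorial (n : ℕ) {y : ℝ} (hy : 0 ≤ y) :
    y ^ n * Real.exp (-y) ≤ n.factorial := by
  have h := Real.pow_div_factorial_le_exp y hy n
  rw [div_le_iff₀ (by positivity)] at h
  rw [Real.exp_neg, ← div_eq_mul_inv, div_le_iff₀ (Real.exp_pos y)]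
  linarith

theorem iteratedDeriv_eq_zero_of_eqOn_Iic {f : ℝ → ℝ} (hf : ContDiff ℝ ∞ f)
    (h0 : ∀ t ≤ 0, f t = 0) (n : ℕ) {t : ℝ} (ht : t ≤ 0) : iteratedDeriv n f t = 0 := by
  have hc : Continuous (iteratedDeriv n f) := hf.continuous_iteratedDeriv n (mod_cast le_top)
  have h1 : EqOn (iteratedDeriv n f) (fun _ => 0) (Iio 0) := by
    intro t ht
    have e : f =ᶠ[𝓝 t] fun _ => 0 := by
      filter_upwards [Iio_mem_nhds ht] with s hs using h0 s (le_of_lt hs)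
    rw [e.iteratedDeriv_eq n]
    simp
  have h2 := h1.closure hc continuous_const
  rw [closure_Iio] at h2
  exact h2 ht

/-- The Gevrey bound comes from Cauchy's estimate on the disc of radius `x / 2` about `x`, on whose
boundary `|e^{-1/w}| ≤ e^{-2/(9x)}`. -/
theorem abs_iteratedDeriv_expNegInvGlue_le (n : ℕ) (x : ℝ) :
    |iteratedDeriv n expNegInvGlue x| ≤ 9 ^ n * (n.factorial : ℝ) ^ 2 := by
  rcases le_or_gt x 0 with hx | hx
  · rw [iteratedDeriv_eq_zero_of_eqOn_Iic expNegInvGlue.contDiff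
      (fun t ht => expNegInvGlue.zero_of_nonpos ht) n hx, abs_zero]
    positivity
  rw [iteratedDeriv_expNegInvGlue_eq_re n hx]
  refine (Complex.abs_re_le_norm _).trans ?_
  have hre : ∀ w ∈ Metric.closedBall (x : ℂ) (x / 2), x / 2 ≤ w.re ∧ ‖w‖ ≤ 3 * x / 2 := by
    intro w hw
    rw [Metric.mem_closedBall, dist_eq_norm] at hw
    have h1 := (abs_le.1 ((Complex.abs_re_le_norm _).trans hw)).1
    rw [Complex.sub_re, Complex.ofReal_re] at h1
    refine ⟨by linarith, ?_⟩
    have h2 : ‖w‖ ≤ ‖w - x‖ + ‖(x : ℂ)‖ := by simpa using norm_add_le (w - x) (x : ℂ)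
    rw [Complex.norm_real, Real.norm_of_nonneg hx.le] at h2
    linarith
  have hne : ∀ w ∈ Metric.closedBall (x : ℂ) (x / 2), w ≠ 0 := by
    rintro w hw rfl
    have := (hre 0 hw).1
    simp at this
    linarith
  have h := Complex.norm_iteratedDeriv_le_of_forall_mem_sphere_norm_le (c := (x : ℂ)) (R := x / 2)
    (C := Real.exp (-(2 / (9 * x)))) (f := fun w : ℂ => Complex.exp (-w⁻¹)) n (half_pos hx) ?_ ?_
  · refine h.trans ?_
    have h1 := pow_mul_exp_neg_le_factorial n (y := 2 / (9 * x)) (by positivity)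
    calc (n.factorial : ℝ) * Real.exp (-(2 / (9 * x))) / (x / 2) ^ n
        = n.factorial * 9 ^ n * ((2 / (9 * x)) ^ n * Real.exp (-(2 / (9 * x)))) := by
          rw [div_pow, div_pow, mul_pow]; field_simp
      _ ≤ n.factorial * 9 ^ n * n.factorial := by gcongr
      _ = _ := by ring
  · refine DifferentiableOn.diffContOnCl_ball (U := {0}ᶜ) (fun w hw => ?_) (fun w hw => hne w hw)
    exact ((differentiableAt_inv hw).neg.cexp).differentiableWithinAt
  · intro w hw
    have hw' := Metric.sphere_subset_closedBall hw
    obtain ⟨h1, h2⟩ := hre w hw'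
    rw [Complex.norm_exp, Real.exp_le_exp, Complex.neg_re, neg_le_neg_iff, Complex.inv_re]
    have h3 : Complex.normSq w ≤ (3 * x / 2) ^ 2 := by
      rw [Complex.normSq_eq_norm_sq]; gcongr
    have h4 : 0 < Complex.normSq w := Complex.normSq_pos.2 (hne w hw')
    calc 2 / (9 * x) = (x / 2) / (3 * x / 2) ^ 2 := by field_simp; norm_num
      _ ≤ w.re / Complex.normSq w := by gcongr; linarith

/-- `f` is smooth on `s` with `‖f⁽ⁿ⁾‖ ≤ C Bⁿ (n!)²` there: Gevrey of order two, where only the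
geometric constant `B` is recorded. -/
def GevreyBound {E : Type*} [NormedAddCommGroup E] [NormedSpace ℝ E] (B : ℝ) (s : Set ℝ)
    (f : ℝ → E) : Prop :=
  ContDiffOn ℝ ∞ f s ∧ ∃ C : ℝ, 0 ≤ C ∧ ∀ n : ℕ, ∀ t ∈ s,
    ‖iteratedDerivWithin n f s t‖ ≤ C * B ^ n * (n.factorial : ℝ) ^ 2

theorem sum_choose_mul_factorial_sq_le (n : ℕ) :
    ∑ i ∈ Finset.range (n + 1), (n.choose i : ℝ) * (i.factorial : ℝ) ^ 2 *
      ((n - i).factorial : ℝ) ^ 2 ≤ 2 ^ n * (n.factorial : ℝ) ^ 2 := by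
  have h1 : ∀ i ∈ Finset.range (n + 1), (n.choose i : ℝ) * (i.factorial : ℝ) ^ 2 *
      ((n - i).factorial : ℝ) ^ 2 ≤ (n.factorial : ℝ) ^ 2 := by
    intro i hi
    have hin : i ≤ n := Nat.lt_succ_iff.1 (Finset.mem_range.1 hi)
    have e : ((n.choose i : ℝ) * i.factorial * (n - i).factorial) = n.factorial := by
      exact_mod_cast Nat.choose_mul_factorial_mul_factorial hin
    have h2 : ((i.factorial : ℝ) * (n - i).factorial) ≤ n.factorial := by
      have := Nat.le_of_dvd (Nat.factorial_pos _) (Nat.factorial_mul_factorial_dvd_factorial hin)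
      exact_mod_cast this
    calc _ = ((n.choose i : ℝ) * i.factorial * (n - i).factorial) *
          (i.factorial * (n - i).factorial) := by ring
      _ ≤ n.factorial * n.factorial := by rw [e]; gcongr
      _ = _ := by ring
  calc _ ≤ ∑ _i ∈ Finset.range (n + 1), (n.factorial : ℝ) ^ 2 := Finset.sum_le_sum h1
    _ = ((n + 1 : ℕ) : ℝ) * (n.factorial : ℝ) ^ 2 := by simp
    _ ≤ 2 ^ n * (n.factorial : ℝ) ^ 2 := by
        gcongr
        exact_mod_cast Nat.lt_two_pow_self

theorem GevreyBound.smul {E : Type*} [NormedAddCommGroup E] [NormedSpace ℝ E] {B : ℝ}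
    {s : Set ℝ} {f : ℝ → ℝ} {g : ℝ → E} (hs : UniqueDiffOn ℝ s) (hB : 0 ≤ B)
    (hf : GevreyBound B s f) (hg : GevreyBound B s g) :
    GevreyBound (2 * B) s (fun t => f t • g t) := by
  obtain ⟨hf, C, hC, hfb⟩ := hf
  obtain ⟨hg, D, hD, hgb⟩ := hg
  refine ⟨hf.smul hg, C * D, by positivity, fun n t ht => ?_⟩
  rw [← norm_iteratedFDerivWithin_eq_norm_iteratedDerivWithin]
  refine (norm_iteratedFDerivWithin_smul_le hf hg hs ht (n := n) (mod_cast le_top)).trans ?_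
  simp only [norm_iteratedFDerivWithin_eq_norm_iteratedDerivWithin]
  calc _ ≤ ∑ i ∈ Finset.range (n + 1), C * D * B ^ n * ((n.choose i : ℝ) *
        (i.factorial : ℝ) ^ 2 * ((n - i).factorial : ℝ) ^ 2) := by
        refine Finset.sum_le_sum fun i hi => ?_
        have hin : i ≤ n := Nat.lt_succ_iff.1 (Finset.mem_range.1 hi)
        calc _ ≤ (n.choose i : ℝ) * (C * B ^ i * (i.factorial : ℝ) ^ 2) *
              (D * B ^ (n - i) * ((n - i).factorial : ℝ) ^ 2) := by
              gcongr
              · exact hfb i t ht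
              · exact hgb _ t ht
          _ = C * D * (B ^ i * B ^ (n - i)) * ((n.choose i : ℝ) *
              (i.factorial : ℝ) ^ 2 * ((n - i).factorial : ℝ) ^ 2) := by ring
          _ = _ := by rw [← pow_add, Nat.add_sub_cancel' hin]
    _ = C * D * B ^ n * _ := (Finset.mul_sum _ _ _).symm
    _ ≤ C * D * B ^ n * (2 ^ n * (n.factorial : ℝ) ^ 2) := by
        gcongr; exact sum_choose_mul_factorial_sq_le n
    _ = _ := by rw [mul_pow]; ring

theorem gevreyBound_expNegInvGlue {b : ℝ} (hb : 0 < b) :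
    GevreyBound (9 * b) univ (fun t => expNegInvGlue (b * t)) := by
  have hc : ContDiff ℝ ∞ expNegInvGlue := expNegInvGlue.contDiff
  refine ⟨(hc.comp (contDiff_const.mul contDiff_id)).contDiffOn, 1, zero_le_one,
    fun n t _ => ?_⟩
  rw [iteratedDerivWithin_univ, iteratedDeriv_comp_const_mul expNegInvGlue.contDiff, one_mul,
    norm_mul, norm_pow, Real.norm_of_nonneg hb.le, mul_pow]
  calc _ ≤ b ^ n * (9 ^ n * (n.factorial : ℝ) ^ 2) := by
        gcongr; exact abs_iteratedDeriv_expNegInvGlue_le _ _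
    _ = _ := by ring

theorem GevreyBound.comp_const_sub {B : ℝ} {f : ℝ → ℝ} (hf : GevreyBound B univ f) (c : ℝ) :
    GevreyBound B univ (fun t => f (c - t)) := by
  obtain ⟨h1, C, hC, hb⟩ := hf
  refine ⟨((contDiffOn_univ.1 h1).comp (contDiff_const.sub contDiff_id)).contDiffOn, C, hC,
    fun n t _ => ?_⟩
  have := hb n (c - t) (mem_univ _)
  rw [iteratedDerivWithin_univ] at this ⊢
  rw [iteratedDeriv_comp_const_sub]
  simpa [norm_smul] using this

/-- The constant `B` may be taken arbitrarily small, which is what makes the power series in space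
of the flat outputs converge on a given interval. -/
theorem exists_gevrey_cutoff {t₁ t₂ B : ℝ} (ht₁ : 0 < t₁) (ht₂ : 0 < t₂) (hB : 0 < B) :
    ∃ χ : ℝ → ℝ, ContDiff ℝ ∞ χ ∧ (∀ t ≤ 0, χ t = 0) ∧ (∀ t, t₁ ≤ t → χ t = 1) ∧
      GevreyBound B (Icc 0 t₂) χ := by
  set b : ℝ := B / 18 with hb
  have hb0 : 0 < b := by positivity
  set g : ℝ → ℝ := fun t => expNegInvGlue (b * t) • expNegInvGlue (b * (t₁ - t)) with hg
  have hgB : GevreyBound B univ g := by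
    have h1 := gevreyBound_expNegInvGlue hb0
    have h2 := h1.smul uniqueDiffOn_univ (by positivity) (h1.comp_const_sub t₁)
    rwa [show 2 * (9 * b) = B by rw [hb]; ring] at h2
  have hgc : ContDiff ℝ ∞ g := contDiffOn_univ.1 hgB.1
  have hg0 : ∀ t ≤ 0, g t = 0 := fun t ht => by
    simp [hg, expNegInvGlue.zero_of_nonpos (mul_nonpos_of_nonneg_of_nonpos hb0.le ht)]
  have hg1 : ∀ t, t₁ ≤ t → g t = 0 := fun t ht => by
    simp [hg, expNegInvGlue.zero_of_nonpos
      (mul_nonpos_of_nonneg_of_nonpos hb0.le (sub_nonpos.2 ht))]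
  have hgpos : ∀ t ∈ Ioo 0 t₁, 0 < g t := fun t ht =>
    mul_pos (expNegInvGlue.pos_of_pos (mul_pos hb0 ht.1))
      (expNegInvGlue.pos_of_pos (mul_pos hb0 (sub_pos.2 ht.2)))
  have hgi : ∀ u v, IntervalIntegrable g MeasureTheory.volume u v :=
    fun u v => hgc.continuous.intervalIntegrable u v
  set c : ℝ := ∫ τ in 0..t₁, g τ with hc
  have hc0 : 0 < c := intervalIntegral.intervalIntegral_pos_of_pos_on (hgi _ _) hgpos ht₁
  set χ : ℝ → ℝ := fun t => c⁻¹ * ∫ τ in 0..t, g τ with hχ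
  have hχd : ∀ t, HasDerivAt χ (c⁻¹ * g t) t := fun t =>
    (intervalIntegral.integral_hasDerivAt_right (hgi _ _)
      (hgc.continuous.stronglyMeasurableAtFilter _ _) hgc.continuous.continuousAt).const_mul _
  have hχd' : deriv χ = fun t => c⁻¹ * g t := funext fun t => (hχd t).deriv
  have hχc : ContDiff ℝ ∞ χ := by
    rw [contDiff_infty_iff_deriv, hχd']
    exact ⟨fun t => (hχd t).differentiableAt, contDiff_const.mul hgc⟩
  refine ⟨χ, hχc, fun t ht => ?_, fun t ht => ?_, hχc.contDiffOn, ?_⟩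
  · simp only [hχ]
    rw [intervalIntegral.integral_congr (g := fun _ => 0) fun s hs => hg0 s ?_]
    · simp
    · rw [uIcc_of_ge ht] at hs; exact hs.2
  · simp only [hχ]
    rw [← intervalIntegral.integral_add_adjacent_intervals (hgi 0 t₁) (hgi t₁ t),
      intervalIntegral.integral_congr (a := t₁) (g := fun _ => 0) fun s hs => hg1 s ?_]
    · simp [← hc, hc0.ne']
    · rw [uIcc_of_le ht] at hs; exact hs.1
  · obtain ⟨-, C, hC, hCb⟩ := hgB
    obtain ⟨M, hM⟩ := isCompact_Icc.exists_bound_of_continuousOn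
      (hχc.continuous.continuousOn (s := Icc 0 t₂))
    refine ⟨|M| + c⁻¹ * C * B⁻¹, by positivity, fun n t ht => ?_⟩
    rw [iteratedDerivWithin_eq_iteratedDeriv (uniqueDiffOn_Icc ht₂)
      (hχc.contDiffAt.of_le (mod_cast le_top)) ht]
    cases n with
    | zero =>
      simp only [iteratedDeriv_zero, pow_zero, Nat.factorial_zero, Nat.cast_one, mul_one, one_pow]
      have : 0 ≤ c⁻¹ * C * B⁻¹ := by positivity
      linarith [hM t ht, le_abs_self M]
    | succ n =>
      rw [iteratedDeriv_succ', hχd', iteratedDeriv_const_mul_field, norm_mul,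
        Real.norm_of_nonneg (by positivity : 0 ≤ c⁻¹)]
      have h3 := hCb n t (mem_univ _)
      rw [iteratedDerivWithin_univ] at h3
      calc _ ≤ c⁻¹ * (C * B ^ n * (n.factorial : ℝ) ^ 2) := by gcongr
        _ ≤ c⁻¹ * (C * B ^ n * ((n + 1).factorial : ℝ) ^ 2) := by
            gcongr; omega
        _ = (c⁻¹ * C * B⁻¹) * B ^ (n + 1) * ((n + 1).factorial : ℝ) ^ 2 := by
            field_simp
            rw [pow_succ, mul_assoc]
        _ ≤ _ := by gcongr; linarith [abs_nonneg M]

/-! ### Superpositions of exponential solutions of the heat equation -/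

/-- A density `G` and frequencies `lam` on a measure space such that the exponential solutions
`e^{λ(x - c) + λ²(t - T)}` of the heat equation can be superposed with weight `G` for `x ∈ [a,b]`
and all `t ≤ T`: the frequencies lie in a sector `Re λ² ≥ κ |λ|²`, and the superposition of the
final states converges with an exponential margin `ε`. -/
structure ExpSuperposition {X : Type*} [MeasurableSpace X] (ν : Measure X) (a b c ε κ : ℝ)
    (G lam : X → ℂ) (E : X → ℝ) : Prop where
  measurable_density : AEStronglyMeasurable G ν
  measurable_freq : AEStronglyMeasurable lam ν
  integrable : Integrable E ν
  margin_pos : 0 < ε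
  sector_pos : 0 < κ
  sector : ∀ ξ, κ * ‖lam ξ‖ ^ 2 ≤ (lam ξ ^ 2).re
  bound : ∀ ξ, ∀ x ∈ Icc a b,
    ‖G ξ‖ * Real.exp ((lam ξ).re * (x - c)) ≤ Real.exp (-(ε * ‖lam ξ‖)) * E ξ

/-- The `n`-th space derivative of the exponential solution with frequency `l` and weight `g`. -/
noncomputable def expSolution (c T : ℝ) (g l : ℂ) (n : ℕ) (x t : ℝ) : ℂ :=
  g * l ^ n * Complex.exp (l * (x - c) - l ^ 2 * (T - t))

/-- The `n`-th space derivative of the superposition of exponential solutions. -/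
noncomputable def superposition {X : Type*} [MeasurableSpace X] (ν : Measure X) (c T : ℝ)
    (G lam : X → ℂ) (n : ℕ) (x t : ℝ) : ℂ :=
  ∫ ξ, expSolution c T (G ξ) (lam ξ) n x t ∂ν

theorem expSolution_hasDerivAt_space (c T : ℝ) (g l : ℂ) (n : ℕ) (x t : ℝ) :
    HasDerivAt (fun x => expSolution c T g l n x t) (expSolution c T g l (n + 1) x t) x := by
  have h0 : HasDerivAt (fun x : ℝ => (x : ℂ)) 1 x := (hasDerivAt_id x).ofReal_comp
  have h1 := ((((h0.sub_const (c : ℂ)).const_mul l).sub_const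
    (l ^ 2 * ((T : ℂ) - t))).cexp).const_mul (g * l ^ n)
  refine h1.congr_deriv ?_
  simp only [expSolution]
  ring

theorem expSolution_hasDerivAt_time (c T : ℝ) (g l : ℂ) (n : ℕ) (x t : ℝ) :
    HasDerivAt (fun t => expSolution c T g l n x t) (expSolution c T g l (n + 2) x t) t := by
  have h0 : HasDerivAt (fun x : ℝ => (x : ℂ)) 1 t := (hasDerivAt_id t).ofReal_comp
  have h1 := ((((h0.const_sub (T : ℂ)).const_mul (l ^ 2)).const_sub
    (l * ((x : ℂ) - c))).cexp).const_mul (g * l ^ n)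
  refine h1.congr_deriv ?_
  simp only [expSolution]
  ring

theorem pow_eq_inv_pow_mul_pow {r : ℝ} (hr : r ≠ 0) (m : ℝ) (n : ℕ) :
    m ^ n = r⁻¹ ^ n * (r * m) ^ n := by
  rw [← mul_pow, ← mul_assoc, inv_mul_cancel₀ hr, one_mul]

namespace ExpSuperposition

variable {X : Type*} [MeasurableSpace X] {ν : Measure X} {a b c ε κ T : ℝ} {G lam : X → ℂ}
  {E : X → ℝ}

theorem nonneg (h : ExpSuperposition ν a b c ε κ G lam E) (hc : c ∈ Icc a b) (ξ : X) :
    0 ≤ E ξ := by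
  have h1 : 0 ≤ Real.exp (-(ε * ‖lam ξ‖)) * E ξ := le_trans (by positivity) (h.bound ξ c hc)
  exact nonneg_of_mul_nonneg_right h1 (Real.exp_pos _)

theorem norm_expSolution_le (h : ExpSuperposition ν a b c ε κ G lam E) (hc : c ∈ Icc a b)
    {δ x t : ℝ} (hδ : 0 ≤ δ) (hx : x ∈ Icc a b) (ht : t ≤ T - δ) (n : ℕ) (ξ : X) :
    ‖expSolution c T (G ξ) (lam ξ) n x t‖ ≤
      ‖lam ξ‖ ^ n * Real.exp (-(ε * ‖lam ξ‖)) * Real.exp (-(κ * δ * ‖lam ξ‖ ^ 2)) * E ξ := by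
  have hs : (lam ξ * ((x : ℂ) - c) - lam ξ ^ 2 * ((T : ℂ) - t)).re
      = (lam ξ).re * (x - c) + -((lam ξ ^ 2).re * (T - t)) := by
    rw [← Complex.ofReal_sub, ← Complex.ofReal_sub, Complex.sub_re, Complex.re_mul_ofReal,
      Complex.re_mul_ofReal]
    ring
  have h1 : κ * δ * ‖lam ξ‖ ^ 2 ≤ (lam ξ ^ 2).re * (T - t) := by
    have h2 := h.sector ξ
    have h3 : 0 ≤ κ * ‖lam ξ‖ ^ 2 := by have := h.sector_pos; positivity
    calc κ * δ * ‖lam ξ‖ ^ 2 = κ * ‖lam ξ‖ ^ 2 * δ := by ring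
      _ ≤ κ * ‖lam ξ‖ ^ 2 * (T - t) := by gcongr; linarith
      _ ≤ _ := by gcongr; linarith
  rw [expSolution, norm_mul, norm_mul, norm_pow, Complex.norm_exp, hs, Real.exp_add]
  calc _ = ‖lam ξ‖ ^ n * (‖G ξ‖ * Real.exp ((lam ξ).re * (x - c))) *
        Real.exp (-((lam ξ ^ 2).re * (T - t))) := by ring
    _ ≤ ‖lam ξ‖ ^ n * (Real.exp (-(ε * ‖lam ξ‖)) * E ξ) *
        Real.exp (-(κ * δ * ‖lam ξ‖ ^ 2)) := by
        have := h.nonneg hc ξ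
        have h2 := h.bound ξ x hx
        gcongr ?_ * ?_
        · exact mul_le_mul_of_nonneg_left h2 (by positivity)
        · exact Real.exp_le_exp.2 (neg_le_neg h1)
    _ = _ := by ring

theorem aestronglyMeasurable (h : ExpSuperposition ν a b c ε κ G lam E) (n : ℕ) (x t : ℝ) :
    AEStronglyMeasurable (fun ξ => expSolution c T (G ξ) (lam ξ) n x t) ν := by
  have h1 := h.measurable_freq
  refine (h.measurable_density.mul (h1.pow n)).mul ?_
  exact Complex.continuous_exp.comp_aestronglyMeasurable
    ((h1.mul_const _).sub ((h1.pow 2).mul_const _))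

theorem norm_expSolution_le_factorial (h : ExpSuperposition ν a b c ε κ G lam E)
    (hc : c ∈ Icc a b) {x t : ℝ} (hx : x ∈ Icc a b) (ht : t ≤ T) (n : ℕ) (ξ : X) :
    ‖expSolution c T (G ξ) (lam ξ) n x t‖ ≤ ε⁻¹ ^ n * n.factorial * E ξ := by
  refine (h.norm_expSolution_le hc le_rfl hx (by linarith) n ξ).trans ?_
  have hε := h.margin_pos
  have e1 := pow_mul_exp_neg_le_factorial n (y := ε * ‖lam ξ‖) (by positivity)
  have e2 := pow_eq_inv_pow_mul_pow hε.ne' ‖lam ξ‖ n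
  refine mul_le_mul_of_nonneg_right ?_ (h.nonneg hc ξ)
  rw [mul_zero, zero_mul, neg_zero, Real.exp_zero, mul_one, e2, mul_assoc]
  gcongr

theorem integrable_expSolution (h : ExpSuperposition ν a b c ε κ G lam E)
    (hc : c ∈ Icc a b) {x t : ℝ} (hx : x ∈ Icc a b) (ht : t ≤ T) (n : ℕ) :
    Integrable (fun ξ => expSolution c T (G ξ) (lam ξ) n x t) ν :=
  (h.integrable.const_mul _).mono' (h.aestronglyMeasurable n x t)
    (Eventually.of_forall (h.norm_expSolution_le_factorial hc hx ht n))

theorem heatJet (h : ExpSuperposition ν a b c ε κ G lam E) (hc : c ∈ Icc a b) :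
    HeatJet (Icc a b) (Icc 0 T) (superposition ν c T G lam) := by
  have hε := h.margin_pos
  refine ⟨fun n x hx t ht => ?_, fun n x hx t ht => ?_, ?_⟩
  · exact hasDerivWithinAt_integral (convex_Icc a b)
      (fun ξ x _ => (expSolution_hasDerivAt_space c T _ _ n x t).hasDerivWithinAt)
      (fun ξ x _ => (expSolution_hasDerivAt_space c T _ _ (n + 1) x t).hasDerivWithinAt)
      (fun ξ x hx => h.norm_expSolution_le_factorial hc hx ht.2 (n + 2) ξ)
      (h.integrable.const_mul _) (fun x hx => h.integrable_expSolution hc hx ht.2 _)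
      (fun x hx => h.integrable_expSolution hc hx ht.2 _) hx
  · exact hasDerivWithinAt_integral (convex_Icc 0 T)
      (fun ξ t _ => (expSolution_hasDerivAt_time c T _ _ n x t).hasDerivWithinAt)
      (fun ξ t _ => (expSolution_hasDerivAt_time c T _ _ (n + 2) x t).hasDerivWithinAt)
      (fun ξ t ht => h.norm_expSolution_le_factorial hc hx ht.2 (n + 4) ξ)
      (h.integrable.const_mul _) (fun t ht => h.integrable_expSolution hc hx ht.2 _)
      (fun t ht => h.integrable_expSolution hc hx ht.2 _) ht
  · have hE : 0 ≤ ∫ ξ, E ξ ∂ν := integral_nonneg (h.nonneg hc)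
    refine ⟨(∫ ξ, E ξ ∂ν) + 1, by positivity, ε⁻¹, by positivity, fun n x hx t ht => ?_⟩
    calc ‖superposition ν c T G lam n x t‖ ≤ ∫ ξ, ε⁻¹ ^ n * n.factorial * E ξ ∂ν :=
          norm_integral_le_of_norm_le (h.integrable.const_mul _)
            (Eventually.of_forall (h.norm_expSolution_le_factorial hc hx ht.2 n))
      _ = (∫ ξ, E ξ ∂ν) * ε⁻¹ ^ n * n.factorial := by rw [integral_const_mul]; ring
      _ ≤ _ := by gcongr; linarith

/-- Away from the final time the superposition is analytic in time: at `x = c` its time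
derivatives grow like `n!`, so it is Gevrey of order two with any constant. -/
theorem gevreyBound (h : ExpSuperposition ν a b c ε κ G lam E) (hc : c ∈ Icc a b)
    {δ t₂ B : ℝ} (hδ : 0 < δ) (ht₂ : 0 < t₂) (ht₂T : t₂ ≤ T - δ) (hB : 0 < B) (j : ℕ) :
    GevreyBound B (Icc 0 t₂) (fun t => superposition ν c T G lam j c t) := by
  have hj : ∀ n, ∀ t ∈ Icc 0 t₂, HasDerivWithinAt (superposition ν c T G lam n c)
      (superposition ν c T G lam (n + 2) c t) (Icc 0 t₂) t := fun n t ht =>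
    ((h.heatJet (T := T) hc).time n c hc t ⟨ht.1, by linarith [ht.2]⟩).mono
      (Icc_subset_Icc_right (by linarith))
  have hε := h.margin_pos
  have hκ := h.sector_pos
  have hE : 0 ≤ ∫ ξ, E ξ ∂ν := integral_nonneg (h.nonneg hc)
  refine ⟨contDiffOn_of_jet (uniqueDiffOn_Icc ht₂) hj j,
    ε⁻¹ ^ j * j.factorial * Real.exp ((κ * δ * B)⁻¹) * ∫ ξ, E ξ ∂ν, by positivity,
    fun n t ht => ?_⟩
  rw [iteratedDerivWithin_eq_of_jet (uniqueDiffOn_Icc ht₂) hj n j ht]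
  have hb : ∀ ξ, ‖expSolution c T (G ξ) (lam ξ) (j + 2 * n) c t‖ ≤
      ε⁻¹ ^ j * j.factorial * ((κ * δ)⁻¹ ^ n * n.factorial) * E ξ := by
    intro ξ
    refine (h.norm_expSolution_le hc hδ.le hc (by linarith [ht.2]) _ ξ).trans ?_
    refine mul_le_mul_of_nonneg_right ?_ (h.nonneg hc ξ)
    have e1 := pow_mul_exp_neg_le_factorial j (y := ε * ‖lam ξ‖) (by positivity)
    have e2 := pow_mul_exp_neg_le_factorial n (y := κ * δ * ‖lam ξ‖ ^ 2) (by positivity)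
    calc ‖lam ξ‖ ^ (j + 2 * n) * Real.exp (-(ε * ‖lam ξ‖)) * Real.exp (-(κ * δ * ‖lam ξ‖ ^ 2))
        = (ε⁻¹ ^ j * ((ε * ‖lam ξ‖) ^ j * Real.exp (-(ε * ‖lam ξ‖)))) *
          ((κ * δ)⁻¹ ^ n * ((κ * δ * ‖lam ξ‖ ^ 2) ^ n *
            Real.exp (-(κ * δ * ‖lam ξ‖ ^ 2)))) := by
          rw [pow_add, pow_mul, pow_eq_inv_pow_mul_pow hε.ne' ‖lam ξ‖ j,
            pow_eq_inv_pow_mul_pow (mul_pos hκ hδ).ne' (‖lam ξ‖ ^ 2) n]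
          ring
      _ ≤ _ := by gcongr
  have hBn := Real.pow_div_factorial_le_exp (κ * δ * B)⁻¹ (by positivity) n
  rw [div_le_iff₀ (by positivity)] at hBn
  calc _ ≤ ∫ ξ, ε⁻¹ ^ j * j.factorial * ((κ * δ)⁻¹ ^ n * n.factorial) * E ξ ∂ν :=
        norm_integral_le_of_norm_le (h.integrable.const_mul _) (Eventually.of_forall hb)
    _ = ε⁻¹ ^ j * j.factorial * ((κ * δ * B)⁻¹ ^ n * (B ^ n * n.factorial)) * ∫ ξ, E ξ ∂ν := by
        rw [integral_const_mul, mul_inv (κ * δ), mul_pow, mul_assoc _ (B⁻¹ ^ n),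
          ← mul_assoc (B⁻¹ ^ n), ← mul_pow B⁻¹, inv_mul_cancel₀ hB.ne', one_pow, one_mul]
    _ ≤ ε⁻¹ ^ j * j.factorial * ((Real.exp (κ * δ * B)⁻¹ * n.factorial) *
          (B ^ n * n.factorial)) * ∫ ξ, E ξ ∂ν := by gcongr
    _ = _ := by ring

/-- Before the final time, the superposition is the sum of its Taylor series in space. -/
theorem hasSum_taylor (h : ExpSuperposition ν a b c ε κ G lam E) (hc : c ∈ Icc a b)
    {δ t : ℝ} (hδ : 0 < δ) (ht : t ≤ T - δ) (x : ℝ) (n : ℕ) :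
    HasSum (fun k : ℕ => superposition ν c T G lam (n + k) c t *
      (((x - c) ^ k / k.factorial : ℝ) : ℂ)) (superposition ν c T G lam n x t) := by
  have hε := h.margin_pos
  have hκ := h.sector_pos
  have hE : 0 ≤ ∫ ξ, E ξ ∂ν := integral_nonneg (h.nonneg hc)
  have htT : t ≤ T := by linarith
  set l : ℝ := |x - c| with hl
  set M : ℝ := ε⁻¹ ^ n * n.factorial * Real.exp (l ^ 2 / (κ * δ)) with hM
  set F : ℕ → X → ℂ := fun k ξ => expSolution c T (G ξ) (lam ξ) (n + k) c t *
      (((x - c) ^ k / k.factorial : ℝ) : ℂ) with hF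
  have hFi : ∀ k, Integrable (F k) ν := fun k =>
    (h.integrable_expSolution hc hc htT (n + k)).mul_const _
  have hFb : ∀ k ξ, ‖F k ξ‖ ≤ (1 / 2) ^ k * (M * E ξ) := by
    intro k ξ
    have e1 := pow_mul_exp_neg_le_factorial n (y := ε * ‖lam ξ‖) (by positivity)
    have e2 := Real.pow_div_factorial_le_exp (2 * (‖lam ξ‖ * l)) (by positivity) k
    have e3 : Real.exp (2 * (‖lam ξ‖ * l)) * Real.exp (-(κ * δ * ‖lam ξ‖ ^ 2)) ≤
        Real.exp (l ^ 2 / (κ * δ)) := by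
      rw [← Real.exp_add, Real.exp_le_exp, le_div_iff₀ (by positivity)]
      nlinarith [sq_nonneg (l - κ * δ * ‖lam ξ‖)]
    have hn : ‖(((x - c) ^ k / k.factorial : ℝ) : ℂ)‖ = l ^ k / k.factorial := by
      rw [Complex.norm_real, Real.norm_eq_abs, abs_div, abs_pow, Nat.abs_cast]
    rw [hF]
    simp only [norm_mul, hn]
    calc _ ≤ (‖lam ξ‖ ^ (n + k) * Real.exp (-(ε * ‖lam ξ‖)) *
            Real.exp (-(κ * δ * ‖lam ξ‖ ^ 2)) * E ξ) * (l ^ k / k.factorial) :=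
          mul_le_mul_of_nonneg_right (h.norm_expSolution_le hc hδ.le hc ht _ ξ) (by positivity)
      _ = (1 / 2) ^ k * ((ε⁻¹ ^ n * ((ε * ‖lam ξ‖) ^ n * Real.exp (-(ε * ‖lam ξ‖)))) *
            ((2 * (‖lam ξ‖ * l)) ^ k / k.factorial * Real.exp (-(κ * δ * ‖lam ξ‖ ^ 2)))
            * E ξ) := by
          have e4 := pow_eq_inv_pow_mul_pow hε.ne' ‖lam ξ‖ n
          have e5 : (‖lam ξ‖ * l) ^ k = (1 / 2) ^ k * (2 * (‖lam ξ‖ * l)) ^ k := by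
            rw [← mul_pow]; congr 1; ring
          rw [mul_pow] at e5
          rw [pow_add, ← mul_assoc (ε⁻¹ ^ n), ← e4]
          linear_combination (‖lam ξ‖ ^ n * Real.exp (-(ε * ‖lam ξ‖)) *
            Real.exp (-(κ * δ * ‖lam ξ‖ ^ 2)) * E ξ / k.factorial) * e5
      _ ≤ (1 / 2) ^ k * ((ε⁻¹ ^ n * n.factorial) *
            (Real.exp (2 * (‖lam ξ‖ * l)) * Real.exp (-(κ * δ * ‖lam ξ‖ ^ 2))) * E ξ) := by
          have := h.nonneg hc ξ
          gcongr
      _ ≤ (1 / 2) ^ k * ((ε⁻¹ ^ n * n.factorial) * Real.exp (l ^ 2 / (κ * δ)) * E ξ) := by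
          have := h.nonneg hc ξ
          gcongr
      _ = _ := by rw [hM]
  have hsum : Summable fun k => ∫ ξ, ‖F k ξ‖ ∂ν := by
    refine Summable.of_nonneg_of_le (fun k => integral_nonneg fun _ => norm_nonneg _)
      (fun k => ?_) (summable_geometric_two.mul_right (M * ∫ ξ, E ξ ∂ν))
    rw [← integral_const_mul, ← integral_const_mul]
    exact integral_mono (hFi k).norm ((h.integrable.const_mul _).const_mul _) (hFb k)
  have key := hasSum_integral_of_summable_integral_norm hFi hsum
  have e1 : (fun k => ∫ ξ, F k ξ ∂ν) = fun k : ℕ => superposition ν c T G lam (n + k) c t *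
      (((x - c) ^ k / k.factorial : ℝ) : ℂ) := funext fun k => integral_mul_const _ _
  have e2 : ∀ ξ, ∑' k, F k ξ = expSolution c T (G ξ) (lam ξ) n x t := by
    intro ξ
    have h1 := (NormedSpace.expSeries_div_hasSum_exp (lam ξ * (x - c))).mul_left
      (G ξ * lam ξ ^ n * Complex.exp (-(lam ξ ^ 2 * (T - t))))
    rw [← Complex.exp_eq_exp_ℂ, mul_assoc _ (Complex.exp _), ← Complex.exp_add] at h1
    rw [expSolution, show lam ξ * (↑x - ↑c) - lam ξ ^ 2 * (↑T - ↑t)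
      = -(lam ξ ^ 2 * (T - t)) + lam ξ * (x - c) by ring, ← h1.tsum_eq]
    refine tsum_congr fun k => ?_
    simp only [hF, expSolution, sub_self, mul_zero, zero_sub, pow_add, mul_pow]
    push_cast
    ring
  rw [e1] at key
  rwa [integral_congr_ae (Eventually.of_forall e2)] at key

end ExpSuperposition

/-! ### Holomorphic functions as superpositions of exponentials -/

/-- The sign of a real number, with value `1` at `0`. -/
noncomputable def sgn (x : ℝ) : ℝ := if 0 ≤ x then 1 else -1

theorem sgn_mul_self (x : ℝ) : sgn x * x = |x| := by
  unfold sgn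
  split_ifs with h
  · rw [one_mul, abs_of_nonneg h]
  · rw [neg_one_mul, abs_of_neg (not_le.1 h)]

theorem sgn_sq (x : ℝ) : sgn x ^ 2 = 1 := by
  unfold sgn
  split_ifs <;> norm_num

theorem abs_sgn (x : ℝ) : |sgn x| = 1 := by
  unfold sgn
  split_ifs <;> norm_num

theorem measurable_sgn : Measurable sgn :=
  Measurable.ite measurableSet_Ici measurable_const measurable_const

/-- The direction of the Laplace transform attached to the point of argument `φ` of a circle. It is
constant on each quadrant, and its square has real part `ρ² - 1`. -/
noncomputable def direction (ρ φ : ℝ) : ℂ :=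
  ⟨sgn (Real.cos φ) * ρ, -sgn (Real.sin φ)⟩

theorem measurable_direction (ρ : ℝ) : Measurable (direction ρ) := by
  have h1 : Measurable fun φ => sgn (Real.cos φ) * ρ :=
    (measurable_sgn.comp Real.measurable_cos).mul_const ρ
  have h2 : Measurable fun φ => -sgn (Real.sin φ) :=
    (measurable_sgn.comp Real.measurable_sin).neg
  exact Complex.measurableEquivRealProd.symm.measurable.comp (h1.prodMk h2)

theorem direction_sq_re (ρ φ : ℝ) : (direction ρ φ ^ 2).re = ρ ^ 2 - 1 := by
  rw [pow_two, Complex.mul_re]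
  simp only [direction]
  linear_combination ρ ^ 2 * sgn_sq (Real.cos φ) - sgn_sq (Real.sin φ)

theorem norm_direction (ρ φ : ℝ) : ‖direction ρ φ‖ = √(ρ ^ 2 + 1) := by
  rw [Complex.norm_eq_sqrt_sq_add_sq]
  congr 1
  simp only [direction]
  linear_combination ρ ^ 2 * sgn_sq (Real.cos φ) + sgn_sq (Real.sin φ)

theorem abs_direction_re {ρ : ℝ} (hρ : 0 ≤ ρ) (φ : ℝ) : |(direction ρ φ).re| = ρ := by
  simp only [direction, abs_mul, abs_sgn, one_mul, abs_of_nonneg hρ]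

/-- The direction makes the Laplace kernel decay at least as fast as the radius of the circle. -/
theorem le_direction_mul_circleMap_re {ρ s : ℝ} (hρ : 1 ≤ ρ) (hs : 0 ≤ s) (φ : ℝ) :
    s ≤ (direction ρ φ * circleMap 0 s φ).re := by
  have e : (direction ρ φ * circleMap 0 s φ).re
      = s * (ρ * |Real.cos φ| + |Real.sin φ|) := by
    rw [circleMap_zero, Complex.exp_mul_I, ← Complex.ofReal_cos, ← Complex.ofReal_sin,
      ← sgn_mul_self, ← sgn_mul_self]
    simp only [direction, Complex.mul_re, Complex.mul_im, Complex.add_re, Complex.add_im,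
      Complex.ofReal_re, Complex.ofReal_im, Complex.I_re, Complex.I_im]
    ring
  rw [e]
  have h1 : 1 ≤ ρ * |Real.cos φ| + |Real.sin φ| := by
    have hc := Real.abs_cos_le_one φ
    have hsn := Real.abs_sin_le_one φ
    have h2 := Real.sin_sq_add_cos_sq φ
    rw [← sq_abs (Real.sin φ), ← sq_abs (Real.cos φ)] at h2
    nlinarith [abs_nonneg (Real.cos φ), abs_nonneg (Real.sin φ)]
  nlinarith

/-- A function holomorphic on a disc of radius larger than `ℓ` about `c` is, on
`[c - ℓ, c + ℓ]`, a superposition of exponentials `e^{λ(x - c)}` with frequencies in the sector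
`Re λ² ≥ κ|λ|²`. In Cauchy's formula the kernel `1 / (ζ - x)` is written as the Laplace integral
`ω ∫₀^∞ e^{-μω(ζ - x)} dμ`, where the direction `ω` depends on the quadrant of `ζ - c`. -/
theorem exists_expSuperposition {c l R : ℝ} (hl : 0 < l) (hR : 1 < R) {f : ℂ → ℂ}
    (hf : DifferentiableOn ℂ f (Metric.ball (c : ℂ) (l * R))) :
    ∃ (ε κ : ℝ) (ν : Measure (ℝ × ℝ)) (G lam : ℝ × ℝ → ℂ) (E : ℝ × ℝ → ℝ),
      ExpSuperposition ν (c - l) (c + l) c ε κ G lam E ∧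
      ∀ T : ℝ, ∀ x ∈ Icc (c - l) (c + l), superposition ν c T G lam 0 x T = f x := by
  obtain ⟨r, hr1, hrR⟩ := exists_between hR
  obtain ⟨ρ, hρ1, hρr⟩ := exists_between hr1
  set s : ℝ := l * r with hs
  have hs0 : 0 < s := by positivity
  have hsR : s < l * R := by rw [hs]; gcongr
  set δ : ℝ := l * (r - ρ) with hδ
  have hδ0 : 0 < δ := mul_pos hl (sub_pos.2 hρr)
  set d : ℝ := √(ρ ^ 2 + 1) with hd
  have hd0 : 0 < d := Real.sqrt_pos.2 (by positivity)
  have hsub : Metric.closedBall (c : ℂ) s ⊆ Metric.ball (c : ℂ) (l * R) :=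
    Metric.closedBall_subset_ball hsR
  have hfc : ContinuousOn f (Metric.sphere (c : ℂ) s) :=
    hf.continuousOn.mono (Metric.sphere_subset_closedBall.trans hsub)
  obtain ⟨M, hM⟩ := (isCompact_sphere (c : ℂ) s).exists_bound_of_continuousOn hfc
  have hmem : ∀ φ, circleMap (c : ℂ) s φ ∈ Metric.sphere (c : ℂ) s :=
    fun φ => circleMap_mem_sphere _ hs0.le φ
  have hM0 : 0 ≤ M := (norm_nonneg _).trans (hM _ (hmem 0))
  set ν : Measure (ℝ × ℝ) :=
    (volume.restrict (Ioc 0 (2 * Real.pi))).prod (volume.restrict (Ioi 0)) with hν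
  -- Taking `|μ|` instead of `μ` makes the bounds below hold off the support of `ν` as well.
  set lam : ℝ × ℝ → ℂ := fun ξ => (|ξ.2| : ℝ) * direction ρ ξ.1 with hlam
  set G : ℝ × ℝ → ℂ := fun ξ => (2 * Real.pi : ℂ)⁻¹ * circleMap 0 s ξ.1 *
    f (circleMap c s ξ.1) * direction ρ ξ.1 *
      Complex.exp (-((|ξ.2| : ℝ) * (direction ρ ξ.1 * circleMap 0 s ξ.1))) with hG
  set D : ℝ := (2 * Real.pi)⁻¹ * s * M * d with hD
  have hD0 : 0 ≤ D := by positivity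
  set E : ℝ × ℝ → ℝ := fun ξ => D * Real.exp (-(δ / 2) * |ξ.2|) with hE
  have hnl : ∀ ξ, ‖lam ξ‖ = |ξ.2| * d := fun ξ => by
    simp only [hlam, norm_mul, Complex.norm_real, Real.norm_eq_abs, abs_abs, norm_direction, hd]
  have hω : Measurable fun ξ : ℝ × ℝ => direction ρ ξ.1 :=
    (measurable_direction ρ).comp measurable_fst
  have hμ : Measurable fun ξ : ℝ × ℝ => ((|ξ.2| : ℝ) : ℂ) := by fun_prop
  have hz : Measurable fun ξ : ℝ × ℝ => circleMap 0 s ξ.1 :=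
    ((continuous_circleMap 0 s).comp continuous_fst).measurable
  have hfz : Measurable fun ξ : ℝ × ℝ => f (circleMap c s ξ.1) :=
    (hfc.comp_continuous ((continuous_circleMap (c : ℂ) s).comp continuous_fst)
      fun ξ => hmem ξ.1).measurable
  have hEi : Integrable E ν := by
    have h1 : Integrable (fun _ : ℝ => D) (volume.restrict (Ioc 0 (2 * Real.pi))) :=
      integrable_const D
    have h2 : Integrable (fun μ : ℝ => Real.exp (-(δ / 2) * |μ|)) (volume.restrict (Ioi 0)) := by
      refine (integrableOn_exp_mul_Ioi (a := -(δ / 2)) (by linarith) 0).congr ?_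
      filter_upwards [ae_restrict_mem measurableSet_Ioi] with μ hμ
      rw [abs_of_pos hμ]
    exact h1.mul_prod h2
  have hsup : ExpSuperposition ν (c - l) (c + l) c (δ / (2 * d)) ((ρ ^ 2 - 1) / d ^ 2)
      G lam E := by
    refine ⟨?_, (hμ.mul hω).aestronglyMeasurable, hEi, by positivity,
      div_pos (by nlinarith) (by positivity), fun ξ => ?_, fun ξ x hx => ?_⟩
    · exact (((((measurable_const.mul hz).mul hfz).mul hω).mul
        (Complex.measurable_exp.comp (hμ.mul (hω.mul hz)).neg))).aestronglyMeasurable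
    · rw [hnl, mul_pow, hlam]
      simp only [mul_pow]
      rw [← Complex.ofReal_pow, Complex.re_ofReal_mul, direction_sq_re, sq_abs]
      refine le_of_eq ?_
      field_simp
    · have h1 : ‖G ξ‖ = (2 * Real.pi)⁻¹ * s * ‖f (circleMap c s ξ.1)‖ * d *
          Real.exp (-(|ξ.2| * (direction ρ ξ.1 * circleMap 0 s ξ.1).re)) := by
        simp only [hG, norm_mul, norm_inv, Complex.norm_exp, Complex.neg_re,
          Complex.re_ofReal_mul, norm_direction, norm_circleMap_zero, Complex.norm_real,
          Complex.norm_ofNat, Real.norm_of_nonneg Real.pi_pos.le, abs_of_pos hs0, hd]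
      have h2 := le_direction_mul_circleMap_re hρ1.le hs0.le ξ.1
      have h3 : (lam ξ).re * (x - c) ≤ |ξ.2| * (ρ * l) := by
        have h4 : |x - c| ≤ l := abs_le.2 ⟨by linarith [hx.1], by linarith [hx.2]⟩
        refine (le_abs_self _).trans ?_
        simp only [hlam, Complex.re_ofReal_mul, abs_mul, abs_abs]
        rw [abs_direction_re (by linarith), mul_assoc]
        gcongr
      calc _ ≤ (2 * Real.pi)⁻¹ * s * M * d * Real.exp (-(|ξ.2| * s)) *
            Real.exp (|ξ.2| * (ρ * l)) := by
            rw [h1]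
            gcongr
            exact hM _ (hmem _)
        _ = D * Real.exp (-(δ * |ξ.2|)) := by
            rw [mul_assoc, ← Real.exp_add, hD, hδ, hs]
            congr 2
            ring
        _ = _ := by
            rw [hnl, hE, mul_left_comm, ← Real.exp_add]
            congr 2
            field_simp
            ring
  refine ⟨_, _, ν, G, lam, E, hsup, fun T x hx => ?_⟩
  have hcmem : c ∈ Icc (c - l) (c + l) := ⟨by linarith, by linarith⟩
  have hint := hsup.integrable_expSolution hcmem hx (le_refl T) 0
  rw [superposition, hν, integral_prod _ (by rwa [hν] at hint)]
  have inner : ∀ φ, ∫ μ in Ioi 0, expSolution c T (G (φ, μ)) (lam (φ, μ)) 0 x T =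
      (2 * Real.pi * Complex.I : ℂ)⁻¹ * (deriv (circleMap (c : ℂ) s) φ •
        ((circleMap (c : ℂ) s φ - x)⁻¹ • f (circleMap c s φ))) := by
    intro φ
    set w := direction ρ φ
    set z := circleMap 0 s φ with hzdef
    have hzc : circleMap (c : ℂ) s φ = c + z := by simp [hzdef, circleMap]
    set A : ℂ := -(w * (z - (x - c))) with hA
    have hre : A.re < 0 := by
      have h2 := le_direction_mul_circleMap_re hρ1.le hs0.le φ
      have h4 : |x - c| ≤ l := abs_le.2 ⟨by linarith [hx.1], by linarith [hx.2]⟩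
      have h5 : w.re * (x - c) ≤ ρ * l := by
        refine (le_abs_self _).trans ?_
        rw [abs_mul, abs_direction_re (by linarith)]
        gcongr
      have h6 : A.re = -(w * z).re + w.re * (x - c) := by
        rw [hA, mul_sub, Complex.neg_re, Complex.sub_re, ← Complex.ofReal_sub,
          Complex.re_mul_ofReal]
        ring
      have h7 : ρ * l < s := by rw [hs, mul_comm]; gcongr
      rw [h6]
      linarith
    have hA0 : A ≠ 0 := by
      intro h; rw [h] at hre; simp at hre
    have hw0 : w ≠ 0 := by
      intro h; apply hA0; rw [hA, h]; simp
    have hzx : z - (x - c) ≠ 0 := by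
      intro h; apply hA0; rw [hA, h]; simp
    have e1 : ∀ μ ∈ Ioi (0 : ℝ), expSolution c T (G (φ, μ)) (lam (φ, μ)) 0 x T =
        ((2 * Real.pi : ℂ)⁻¹ * z * f (circleMap c s φ) * w) * Complex.exp (A * μ) := by
      intro μ hμ
      simp only [expSolution, hG, hlam, pow_zero, mul_one, sub_self, mul_zero, sub_zero,
        abs_of_pos (mem_Ioi.1 hμ)]
      rw [mul_assoc _ (Complex.exp _), ← Complex.exp_add]
      congr 2
      rw [hA]
      ring
    rw [setIntegral_congr_fun measurableSet_Ioi e1, integral_const_mul,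
      integral_exp_mul_complex_Ioi hre, deriv_circleMap, hzc]
    have hpi : (Real.pi : ℂ) ≠ 0 := Complex.ofReal_ne_zero.2 Real.pi_ne_zero
    have hzx' : (c : ℂ) + z - x ≠ 0 := by
      intro h; apply hzx; rw [← h]; ring
    simp only [Complex.ofReal_zero, mul_zero, Complex.exp_zero, smul_eq_mul, hA, ← hzdef]
    rw [show z - ((x : ℂ) - c) = c + z - x by ring]
    field_simp
  simp only [inner]
  rw [integral_const_mul, ← intervalIntegral.integral_of_le (by positivity)]
  have hdc : DiffContOnCl ℂ f (Metric.ball (c : ℂ) s) :=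
    (hf.mono hsub).diffContOnCl_ball le_rfl
  have hxb : (x : ℂ) ∈ Metric.ball (c : ℂ) s := by
    rw [Metric.mem_ball, dist_eq_norm, ← Complex.ofReal_sub, Complex.norm_real, Real.norm_eq_abs]
    have h4 : |x - c| ≤ l := abs_le.2 ⟨by linarith [hx.1], by linarith [hx.2]⟩
    have : l * 1 < s := by rw [hs]; gcongr
    linarith
  have key := hdc.circleIntegral_sub_inv_smul hxb
  rw [circleIntegral] at key
  rw [key, smul_eq_mul, ← mul_assoc, inv_mul_cancel₀ Complex.two_pi_I_ne_zero, one_mul]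

/-! ### Solutions of the heat equation from flat outputs -/

/-- The power series in `x - c` with coefficients `F n t, F (n + 1) t, …`. If `F (n + 2)` is the
derivative of `F n`, these are the space derivatives of the solution of the heat equation with
`ψ(c,t) = F 0 t` and `ψₓ(c,t) = F 1 t`. -/
noncomputable def flatSeries (c : ℝ) (F : ℕ → ℝ → ℂ) (n : ℕ) (x t : ℝ) : ℂ :=
  ∑' k : ℕ, F (n + k) t * (((x - c) ^ k / k.factorial : ℝ) : ℂ)

/-- The `j`-th derivative of the monomial `(x - c)ᵏ / k!`. -/
noncomputable def monomialDeriv (c : ℝ) (j k : ℕ) (x : ℝ) : ℂ :=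
  if k < j then 0 else (((x - c) ^ (k - j) / (k - j).factorial : ℝ) : ℂ)

theorem hasDerivAt_monomialDeriv (c : ℝ) (j k : ℕ) (x : ℝ) :
    HasDerivAt (monomialDeriv c j k) (monomialDeriv c (j + 1) k x) x := by
  rcases lt_trichotomy k j with h | rfl | h
  · have e : monomialDeriv c j k = fun _ => 0 := by ext; simp [monomialDeriv, h]
    rw [e, monomialDeriv, if_pos (by omega)]
    exact hasDerivAt_const _ _
  · have e : monomialDeriv c k k = fun _ => 1 := by ext; simp [monomialDeriv]
    rw [e, monomialDeriv, if_pos (by omega)]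
    exact hasDerivAt_const _ _
  · obtain ⟨m, rfl⟩ : ∃ m, k = j + 1 + m := ⟨k - (j + 1), by omega⟩
    have e : monomialDeriv c j (j + 1 + m) =
        fun x => (((x - c) ^ (m + 1) / (m + 1).factorial : ℝ) : ℂ) := by
      ext x
      rw [monomialDeriv, if_neg (by omega), show j + 1 + m - j = m + 1 by omega]
    rw [e, monomialDeriv, if_neg (by omega), show j + 1 + m - (j + 1) = m by omega]
    have h1 : HasDerivAt (fun x : ℝ => (x - c) ^ (m + 1) / (m + 1).factorial)
        ((x - c) ^ m / m.factorial) x := by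
      have h2 := (((hasDerivAt_id x).sub_const c).pow (m + 1)).div_const ((m + 1).factorial : ℝ)
      refine h2.congr_deriv ?_
      rw [Nat.factorial_succ]
      push_cast
      simp only [id_eq]
      field_simp
    exact h1.ofReal_comp

section FlatSeries

variable {c l A C : ℝ} {F : ℕ → ℝ → ℂ}

theorem norm_flatSeries_term_le (hC : 0 ≤ C) (hA : 0 < A) (hAl : 4 * A * l ≤ 1) {x t : ℝ}
    (hF : ∀ n, ‖F n t‖ ≤ C * A ^ n * n.factorial) (hx : x ∈ Icc (c - l) (c + l)) (n k : ℕ) :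
    ‖F (n + k) t * (((x - c) ^ k / k.factorial : ℝ) : ℂ)‖ ≤
      C * (2 * A) ^ n * n.factorial * (1 / 2) ^ k := by
  have h1 : |x - c| ≤ l := abs_le.2 ⟨by linarith [hx.1], by linarith [hx.2]⟩
  have h2 : (2 * A) * |x - c| ≤ 1 / 2 := by nlinarith
  have h3 := factorial_add_le n k
  rw [norm_mul, Complex.norm_real, Real.norm_eq_abs, abs_div, abs_pow, Nat.abs_cast]
  calc _ ≤ (C * A ^ (n + k) * (2 ^ (n + k) * n.factorial * k.factorial)) *
        (|x - c| ^ k / k.factorial) := by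
        gcongr
        exact (hF _).trans (by gcongr)
    _ = C * (2 * A) ^ n * n.factorial * ((2 * A) * |x - c|) ^ k := by
        rw [pow_add, pow_add, mul_pow, mul_pow, mul_pow]
        field_simp
    _ ≤ _ := by gcongr

theorem summable_flatSeries (hC : 0 ≤ C) (hA : 0 < A) (hAl : 4 * A * l ≤ 1) {x t : ℝ}
    (hF : ∀ n, ‖F n t‖ ≤ C * A ^ n * n.factorial) (hx : x ∈ Icc (c - l) (c + l)) (n : ℕ) :
    Summable fun k : ℕ => F (n + k) t * (((x - c) ^ k / k.factorial : ℝ) : ℂ) :=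
  Summable.of_norm_bounded (summable_geometric_two.mul_left _)
    (norm_flatSeries_term_le hC hA hAl hF hx n)

theorem heatJet_flatSeries (hC : 0 < C) (hA : 0 < A) (hAl : 4 * A * l ≤ 1) {J : Set ℝ}
    (hJ : Convex ℝ J) (hF : ∀ n, ∀ t ∈ J, ‖F n t‖ ≤ C * A ^ n * n.factorial)
    (hd : ∀ n, ∀ t ∈ J, HasDerivWithinAt (F n) (F (n + 2) t) J t) :
    HeatJet (Icc (c - l) (c + l)) J (flatSeries c F) := by
  refine ⟨fun n x hx t ht => ?_, fun n x hx t ht => ?_, ?_⟩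
  · have hFt := fun n => hF n t ht
    have shift : ∀ j k x, F (n + (k + j)) t * monomialDeriv c j (k + j) x =
        F (n + j + k) t * (((x - c) ^ k / k.factorial : ℝ) : ℂ) := fun j k x => by
      rw [monomialDeriv, if_neg (by omega), Nat.add_sub_cancel, Nat.add_right_comm, Nat.add_assoc]
    have hsum : ∀ j, ∀ x ∈ Icc (c - l) (c + l),
        Summable fun k => F (n + k) t * monomialDeriv c j k x := fun j x hx => by
      rw [← summable_nat_add_iff j]
      simp only [shift]
      exact summable_flatSeries hC.le hA hAl hFt hx (n + j)
    have key := hasDerivWithinAt_tsum' (convex_Icc (c - l) (c + l))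
      (f := fun k x => F (n + k) t * monomialDeriv c 0 k x)
      (f' := fun k x => F (n + k) t * monomialDeriv c 1 k x)
      (f'' := fun k x => F (n + k) t * monomialDeriv c 2 k x)
      (B := fun k => if k < 2 then 0 else
        C * (2 * A) ^ (n + 2) * (n + 2).factorial * (1 / 2) ^ (k - 2))
      (fun k x _ => ((hasDerivAt_monomialDeriv c 0 k x).const_mul _).hasDerivWithinAt)
      (fun k x _ => ((hasDerivAt_monomialDeriv c 1 k x).const_mul _).hasDerivWithinAt)
      (fun k x hx => ?_) ?_ (hsum 0) (hsum 1) hx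
    · have e0 : (fun ξ => flatSeries c F n ξ t) =
          fun ξ => ∑' k, F (n + k) t * monomialDeriv c 0 k ξ := by
        ext ξ
        simp [flatSeries, monomialDeriv]
      have e1 : flatSeries c F (n + 1) x t = ∑' k, F (n + k) t * monomialDeriv c 1 k x := by
        rw [(hsum 1 x hx).tsum_eq_zero_add]
        simp only [shift]
        simp [flatSeries, monomialDeriv]
      rw [e0, e1]
      exact key
    · by_cases hk : k < 2
      · simp [monomialDeriv, hk]
      · obtain ⟨m, rfl⟩ : ∃ m, k = m + 2 := ⟨k - 2, by omega⟩
        rw [if_neg hk, shift, Nat.add_sub_cancel]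
        exact norm_flatSeries_term_le hC.le hA hAl hFt hx (n + 2) m
    · rw [← summable_nat_add_iff 2]
      simpa using summable_geometric_two.mul_left (C * (2 * A) ^ (n + 2) * (n + 2).factorial)
  · have hterm : ∀ n k, ∀ t ∈ J, HasDerivWithinAt
        (fun τ => F (n + k) τ * (((x - c) ^ k / k.factorial : ℝ) : ℂ))
        (F (n + 2 + k) t * (((x - c) ^ k / k.factorial : ℝ) : ℂ)) J t := fun n k t ht => by
      rw [Nat.add_right_comm n 2 k]
      exact (hd (n + k) t ht).mul_const _
    exact hasDerivWithinAt_tsum' hJ (hterm n) (hterm (n + 2))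
      (fun k t ht => norm_flatSeries_term_le hC.le hA hAl (fun n => hF n t ht) hx (n + 4) k)
      (summable_geometric_two.mul_left _)
      (fun t ht => summable_flatSeries hC.le hA hAl (fun n => hF n t ht) hx n)
      (fun t ht => summable_flatSeries hC.le hA hAl (fun n => hF n t ht) hx (n + 2)) ht
  · refine ⟨2 * C, by positivity, 2 * A, by positivity, fun n x hx t ht => ?_⟩
    refine (tsum_of_norm_bounded (summable_geometric_two.mul_left _).hasSum
      (norm_flatSeries_term_le hC.le hA hAl (fun n => hF n t ht) hx n)).trans (le_of_eq ?_)
    rw [tsum_mul_left, tsum_geometric_two]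
    ring

end FlatSeries

/-- Two jets which agree on an overlap in time are glued inside the overlap. -/
theorem HeatJet.glue {I : Set ℝ} {W U : ℕ → ℝ → ℝ → ℂ} {t₁ t₂ t₃ T : ℝ} (h13 : t₁ < t₃)
    (h32 : t₃ < t₂) (hW : HeatJet I (Icc 0 t₂) W) (hU : HeatJet I (Icc 0 T) U)
    (hWU : ∀ n, ∀ x ∈ I, ∀ t ∈ Icc 0 t₂, t₁ < t → W n x t = U n x t) :
    HeatJet I (Icc 0 T) (fun n x t => if t < t₃ then W n x t else U n x t) := by
  refine ⟨fun n x hx t ht => ?_, fun n x hx t ht => ?_, ?_⟩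
  · by_cases h : t < t₃
    · simp only [if_pos h]
      exact hW.space n x hx t ⟨ht.1, (h.trans h32).le⟩
    · simp only [if_neg h]
      exact hU.space n x hx t ht
  · by_cases h : t < t₃
    · simp only [if_pos h]
      have h1 := hW.time n x hx t ⟨ht.1, (h.trans h32).le⟩
      have h2 : HasDerivWithinAt (fun τ => W n x τ) (W (n + 2) x t) (Icc 0 T) t := by
        refine h1.mono_of_mem_nhdsWithin ?_
        filter_upwards [self_mem_nhdsWithin, mem_nhdsWithin_of_mem_nhds (Iio_mem_nhds h)]
          with τ hτ hτ' using ⟨hτ.1, (hτ'.out.trans h32).le⟩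
      refine h2.congr_of_eventuallyEq ?_ (if_pos h)
      filter_upwards [mem_nhdsWithin_of_mem_nhds (Iio_mem_nhds h)] with τ hτ using if_pos hτ
    · simp only [if_neg h]
      refine (hU.time n x hx t ht).congr_of_eventuallyEq ?_ (if_neg h)
      filter_upwards [self_mem_nhdsWithin,
        mem_nhdsWithin_of_mem_nhds (Ioi_mem_nhds (h13.trans_le (not_lt.1 h)))] with τ hτ hτ'
      split_ifs with h'
      · exact hWU n x hx τ ⟨hτ.1, (h'.trans h32).le⟩ hτ'
      · rfl
  · obtain ⟨C, hC, K, hK, hb⟩ := hW.bound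
    obtain ⟨C', hC', K', hK', hb'⟩ := hU.bound
    refine ⟨C + C', by positivity, K + K', by positivity, fun n x hx t ht => ?_⟩
    by_cases h : t < t₃
    · simp only [if_pos h]
      refine (hb n x hx t ⟨ht.1, (h.trans h32).le⟩).trans ?_
      gcongr <;> linarith
    · simp only [if_neg h]
      refine (hb' n x hx t ht).trans ?_
      gcongr <;> linarith

/-! ### Steering the zero state to a holomorphic final state -/

/-- The superposition `U` of exponential solutions attains the final state but not the initial one.
Multiplying its flat outputs `U 0 c` and `U 1 c` by a cut-off in time produces a solution that
vanishes initially, and leaves `U` unchanged near the final time. The cut-off lives where the flat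
outputs are analytic, so the only loss in the convergence of the power series is that of the
cut-off, which is as small as desired. -/
theorem exists_heatJet {c l R T : ℝ} (hl : 0 < l) (hR : 1 < R) (hT : 0 < T) {f : ℂ → ℂ}
    (hf : DifferentiableOn ℂ f (Metric.ball (c : ℂ) (l * R))) :
    ∃ V : ℕ → ℝ → ℝ → ℂ, HeatJet (Icc (c - l) (c + l)) (Icc 0 T) V ∧
      (∀ x ∈ Icc (c - l) (c + l), V 0 x 0 = 0) ∧
      ∀ x ∈ Icc (c - l) (c + l), V 0 x T = f x := by
  obtain ⟨ε, κ, ν, G, lam, E, hsup, hval⟩ := exists_expSuperposition hl hR hf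
  have hc : c ∈ Icc (c - l) (c + l) := ⟨by linarith, by linarith⟩
  set U := superposition ν c T G lam with hU
  have hUj : HeatJet (Icc (c - l) (c + l)) (Icc 0 T) U := hsup.heatJet hc
  have ht₂ : 0 < 3 * T / 4 := by positivity
  set J : Set ℝ := Icc 0 (3 * T / 4) with hJ
  have hJu : UniqueDiffOn ℝ J := uniqueDiffOn_Icc ht₂
  have hδ : (0 : ℝ) < T / 4 := by positivity
  -- Flat outputs of this size have power series which converge on `[c - l, c + l]`.
  set A : ℝ := (4 * l)⁻¹ with hA
  have hA0 : 0 < A := by positivity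
  have hAl : 4 * A * l ≤ 1 := le_of_eq (by rw [hA]; field_simp)
  obtain ⟨χ, hχc, hχ0, hχ1, hχg⟩ := exists_gevrey_cutoff (t₁ := T / 4) (t₂ := 3 * T / 4)
    (B := A ^ 2 / 2) hδ ht₂ (by positivity)
  have hUg : ∀ j, GevreyBound (A ^ 2 / 2) J (fun t => U j c t) := fun j =>
    hsup.gevreyBound hc hδ ht₂ (by linarith) (by positivity) j
  have hY : ∀ j, GevreyBound (A ^ 2) J (fun t => χ t • U j c t) := fun j => by
    have := hχg.smul hJu (by positivity) (hUg j)
    rwa [mul_div_cancel₀ _ (two_ne_zero' ℝ)] at this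
  set F : ℕ → ℝ → ℂ :=
    fun n => iteratedDerivWithin (n / 2) (fun t => χ t • U (n % 2) c t) J with hF
  have hFd : ∀ n, ∀ t ∈ J, HasDerivWithinAt (F n) (F (n + 2) t) J t := by
    intro n t ht
    have e : F (n + 2) = derivWithin (F n) J := by
      simp only [hF, Nat.add_mod_right, Nat.add_div_right n two_pos, iteratedDerivWithin_succ]
    rw [e]
    exact ((hY (n % 2)).1.differentiableOn_iteratedDerivWithin
      (mod_cast WithTop.coe_lt_top _) hJu t ht).hasDerivWithinAt
  obtain ⟨-, C₀, hC₀, hb₀⟩ := hY 0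
  obtain ⟨-, C₁, hC₁, hb₁⟩ := hY 1
  have hFb : ∀ n, ∀ t ∈ J, ‖F n t‖ ≤ (C₀ + C₁ * A⁻¹ + 1) * A ^ n * n.factorial := by
    intro n t ht
    have hfac : ∀ i : ℕ, (i.factorial : ℝ) ^ 2 ≤ (2 * i).factorial := fun i => by
      rw [pow_two, two_mul]
      exact_mod_cast Nat.le_of_dvd (Nat.factorial_pos _)
        (Nat.factorial_mul_factorial_dvd_factorial_add i i)
    have hCA : 0 ≤ C₁ * A⁻¹ := by positivity
    obtain ⟨i, rfl | rfl⟩ := Nat.even_or_odd' n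
    · have e : F (2 * i) t = iteratedDerivWithin i (fun t => χ t • U 0 c t) J t := by
        simp only [hF]; rw [show 2 * i / 2 = i by omega, show 2 * i % 2 = 0 by omega]
      rw [e]
      refine (hb₀ i t ht).trans ?_
      rw [← pow_mul]
      gcongr
      · linarith
      · exact hfac i
    · have e : F (2 * i + 1) t = iteratedDerivWithin i (fun t => χ t • U 1 c t) J t := by
        simp only [hF]; rw [show (2 * i + 1) / 2 = i by omega, show (2 * i + 1) % 2 = 1 by omega]
      rw [e]
      refine (hb₁ i t ht).trans ?_
      have h1 : ((2 * i).factorial : ℝ) ≤ (2 * i + 1).factorial := by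
        exact_mod_cast Nat.factorial_le (Nat.le_succ _)
      calc _ ≤ C₁ * (A ^ 2) ^ i * (2 * i + 1).factorial := by
            gcongr; exact (hfac i).trans h1
        _ = C₁ * A⁻¹ * A ^ (2 * i + 1) * (2 * i + 1).factorial := by
            rw [← pow_mul, pow_succ]; field_simp
        _ ≤ _ := by gcongr; linarith
  have hW := heatJet_flatSeries (c := c) (l := l) (by positivity) hA0 hAl
    (convex_Icc 0 (3 * T / 4)) hFb hFd
  -- Past the support of `χ'` the flat outputs are the original ones, and so is the solution.
  have hFU : ∀ n, ∀ t ∈ J, T / 4 < t → F n t = U n c t := by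
    intro n t ht htT
    have h1 : (fun t => χ t • U (n % 2) c t) =ᶠ[𝓝[J] t] U (n % 2) c := by
      filter_upwards [mem_nhdsWithin_of_mem_nhds (Ioi_mem_nhds htT)] with τ hτ
      rw [hχ1 τ (le_of_lt hτ), one_smul]
    have h2 := iteratedDerivWithin_eq_of_jet hJu (F := fun n => U n c) (r := 2)
      (fun n t ht => (hUj.time n c hc t ⟨ht.1, by linarith [ht.2]⟩).mono
        (Icc_subset_Icc_right (by linarith))) (n / 2) (n % 2) ht
    simp only [hF]
    rw [h1.iteratedDerivWithin_eq (by rw [hχ1 t htT.le, one_smul]), h2, Nat.mod_add_div]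
  have hF0 : ∀ n, F n 0 = 0 := by
    intro n
    have h0 : (0 : ℝ) ∈ J := left_mem_Icc.2 ht₂.le
    simp only [hF]
    have h1 := iteratedDerivWithin_smul (n := n / 2) h0 hJu
      ((hχc.contDiffAt.contDiffWithinAt).of_le (mod_cast le_top))
      ((((hUg (n % 2)).1) 0 h0).of_le (mod_cast le_top))
    refine h1.trans (Finset.sum_eq_zero fun i _ => ?_)
    rw [iteratedDerivWithin_eq_iteratedDeriv hJu (hχc.contDiffAt.of_le (mod_cast le_top)) h0,
      iteratedDeriv_eq_zero_of_eqOn_Iic hχc hχ0 i le_rfl, zero_smul, smul_zero]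
  refine ⟨_, hW.glue (t₁ := T / 4) (t₃ := T / 2) (by linarith) (by linarith) hUj ?_, ?_, ?_⟩
  · intro n x hx t ht htT
    have h1 := hsup.hasSum_taylor (T := T) hc hδ (by linarith [ht.2]) x n (t := t)
    exact (tsum_congr fun k => by rw [hFU _ t ht htT]).trans h1.tsum_eq
  · intro x hx
    simp [half_pos hT, flatSeries, hF0]
  · intro x hx
    rw [if_neg (by linarith)]
    exact hval T x hx

theorem exists_controls {c l R T : ℝ} (hl : 0 < l) (hR : 1 < R) (hT : 0 < T)
    {α₀ β₀ α₁ β₁ : ℝ} (h₀ne : (α₀, β₀) ≠ (0, 0)) (h₁ne : (α₁, β₁) ≠ (0, 0)) {f : ℂ → ℂ}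
    (hf : DifferentiableOn ℂ f (Metric.ball (c : ℂ) (l * R))) :
    ∃ h₀ h₁ : ℝ → ℂ, GevreyOn 2 0 T h₀ ∧ GevreyOn 2 0 T h₁ ∧
      ∃ ψ : ℝ → ℝ → ℂ,
        IsTheControlledHeatSolution (c - l) (c + l) T α₀ β₀ α₁ β₁ h₀ h₁ ψ ∧
        GevreyOnRect 1 2 (c - l) (c + l) 0 T ψ ∧
        ∀ x ∈ Icc (c - l) (c + l), ψ x T = f x := by
  obtain ⟨V, hV, hV0, hVT⟩ := exists_heatJet hl hR hT hf
  have hab : c - l < c + l := by linarith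
  have hsol := hV.isControlledHeatSolution hab hT hV0 α₀ β₀ α₁ β₁
  exact ⟨_, _, hV.gevreyOn_boundary hT (left_mem_Icc.2 hab.le) α₀ β₀,
    hV.gevreyOn_boundary hT (right_mem_Icc.2 hab.le) α₁ β₁, V 0,
    ⟨hsol, fun φ hφ => controlledHeatSolution_unique hab hT h₀ne h₁ne hφ hsol⟩, hV.gevreyOnRect hab hT, hVT⟩

end HeatControl

theorem mainTheorem2 (T R : ℝ) (hT : 0 < T) (hR : criticalRadius < R) :
    (∀ α₀ β₀ α₁ β₁ : ℝ, (α₀, β₀) ≠ (0, 0) → (α₁, β₁) ≠ (0, 0) →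
      ∀ ψT : ℂ → ℂ, DifferentiableOn ℂ ψT (Metric.ball 0 R) →
        ∃ h₀ h₁ : ℝ → ℂ, GevreyOn 2 0 T h₀ ∧ GevreyOn 2 0 T h₁ ∧
          ∃ ψ : ℝ → ℝ → ℂ,
            IsTheControlledHeatSolution (-1) 1 T α₀ β₀ α₁ β₁ h₀ h₁ ψ ∧
            GevreyOnRect 1 2 (-1) 1 0 T ψ ∧
            ∀ x ∈ Set.Icc (-1 : ℝ) 1, ψ x T = ψT (x : ℂ)) ∧
    (∀ ψ₁ : ℂ → ℂ, DifferentiableOn ℂ ψ₁ (Metric.ball (1 / 2) (R / 2)) →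
        ∃ h₀ h₁ : ℝ → ℂ, GevreyOn 2 0 T h₀ ∧ GevreyOn 2 0 T h₁ ∧
          ∃ ψ : ℝ → ℝ → ℂ,
            IsTheControlledHeatSolution 0 1 T 1 0 1 0 h₀ h₁ ψ ∧
            GevreyOnRect 1 2 0 1 0 T ψ ∧
            ∀ x ∈ Set.Icc (0 : ℝ) 1, ψ x T = ψ₁ (x : ℂ)) := by
  have hR1 : 1 < R := lt_trans (Real.one_lt_exp_iff.2 (by positivity)) hR
  refine ⟨fun α₀ β₀ α₁ β₁ h₀ h₁ ψT hψ => ?_, fun ψ₁ hψ => ?_⟩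
  · have h := HeatControl.exists_controls (c := 0) one_pos hR1 hT h₀ h₁ (f := ψT)
      (by simpa using hψ)
    simpa only [zero_sub, zero_add] using h
  · have h := HeatControl.exists_controls (c := 1 / 2) (l := 1 / 2) (by norm_num) hR1 hT
      (α₀ := 1) (β₀ := 0) (α₁ := 1) (β₁ := 0) (by simp) (by simp) (f := ψ₁)
      (by
        have e : (((1 / 2 : ℝ) : ℂ)) = 1 / 2 := by push_cast; rfl
        rwa [e, one_div_mul_eq_div])
    rw [sub_self, add_halves] at h
    exact h
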